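/- Conventions. A (finite) electrical network $G$ is a connected simple graph with finite vertex set $V_G$ and symmetric conductances $\mu_G(x,y)\ge 0$, positive exactly on the edges. Put $\mu_G(x)=\sum_y\mu_G(x,y)$; $R_G$ is the effective resistance metric of $G$, i.e. the resistance metric of the form $\mathcal E_G(f,f)=\frac12\sum_{x,y}\mu_G(x,y)(f(x)-f(y))^2$; and $\dot\mu^{\#}_G=\sum_{x\in V_G}\delta_{(x,\mu_G(x))}$ is the pushforward of the counting measure under $x\mapsto(x,\mu_G(x))$, a measure on $V_G\times[0,\infty)$. A compact resistance metric space $(F,R)$ is a compact metric space whose metric is the resistance metric $$R(x,y)=\sup\{|f(x)-f(y)|^2/\mathcal E(f,f): f\in\mathcal F,\ \mathcal E(f,f)>0\}$$ of a (corresponding) resistance form $(\mathcal E,\mathcal F)$ on $F$. For finitely many disjoint finite sets $\Gamma=\{V_i\}$ in $F$, let $\pi:F\to F^\Gamma$ be the map collapsing each $V_i$ to a point; the space *fused over* $\Gamma$ is $(F^\Gamma,R^\Gamma)$, where $R^\Gamma$ is the resistance metric of the form $\mathcal E^\Gamma(f,f)=\mathcal E(f\circ\pi,f\circ\pi)$ with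 domain $\{f:F^\Gamma\to\mathbb R\mid f\circ\pi\in\mathcal F\}$. For $k\ge0$, consider tuples $(S,d,\rho,\nu,(p_j)_{j\le k})$ of a compact metric space with root $\rho\in S$, a finite Borel measure $\nu$ on $S\times[0,\infty)$ and $k$ points of $S$. The distance of two such tuples (indexed $1,2$) is the infimum, over all rooted compact metric spaces $M$ and root- and distance-preserving maps $f_i:S_i\to M$, of the maximum of the Hausdorff distance of $f_1(S_1),f_2(S_2)$ in $M$, the Prohorov distance of $\nu_1\circ(f_1\times\mathrm{id})^{-1}$, $\nu_2\circ(f_2\times\mathrm{id})^{-1}$ on $M\times[0,\infty)$ (with the maximum metric), and the distances of $f_1(p_j^1),f_2(p_j^2)$ in $M$ for $j\le k$. Convergence below is with respect to this distance. **Theorem.** For each $n\ge1$ let $G_n$ be a finite electrical network with root $\rho_{G_n}\in V_{G_n}$, all of whose positive conductances equal $1$, and let $a^{(n)}_i\ne b^{(n)}_i$ $(1\le i\le N)$ be vertices of $G_n$ such that $\{a^{(n)}_1,b^{(n)}_1\},\dots,\{a^{(n)}_N,b^{(n)}_N\}$ are distinct. Let $\bar G_n$ be the network with the same vertices and root and with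 conductances $\mu_{\bar G_n}(x,y)=\mu_{G_n}(x,y)+1$ if $\{x,y\}=\{a^{(n)}_i,b^{(n)}_i\}$ for some $i$, and $\mu_{\bar G_n}(x,y)=\mu_{G_n}(x,y)$ otherwise. Let $(F,R)$ be a compact resistance metric space with root $\rho$, let $a_1,b_1,\dots,a_N,b_N$ be $2N$ distinct points of $F$, and let $\dot\mu$ be a finite Borel measure on $F\times[0,\infty)$. Let $\alpha_n,\beta_n>0$ with $\min(\alpha_n,\beta_n)\to\infty$, and assume that $$\bigl(V_{G_n},\alpha_n^{-1}R_{G_n},\rho_{G_n},\beta_n^{-1}\dot\mu^{\#}_{G_n},(a^{(n)}_i,b^{(n)}_i)_{i=1}^N\bigr)\to\bigl(F,R,\rho,\dot\mu,(a_i,b_i)_{i=1}^N\bigr).$$ Then $$\bigl(V_{\bar G_n},\alpha_n^{-1}R_{\bar G_n},\rho_{\bar G_n},\beta_n^{-1}\dot\mu^{\#}_{\bar G_n}\bigr)\to\bigl(\tilde F,\tilde R,\tilde\rho,\dot\mu\circ(\pi\times\mathrm{id}_{[0,\infty)})^{-1}\bigr),$$ where $(\tilde F,\tilde R)$ is $(F,R)$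 fused over $\{\{a_i,b_i\}\}_{i=1}^N$, $\pi:F\to\tilde F$ is the canonical map, and $\tilde\rho=\pi(\rho)$. -/

import Mathlib

open Filter Topology MeasureTheory
open scoped NNReal ENNReal

universe u

noncomputable section

/-- A resistance form on a set `F`: a symmetric bilinear form on a space `domain` of real functions
on `F`, subject to the five axioms (RF1)-(RF5). -/
structure ResistanceForm (F : Type u) where
  /-- the space of functions of finite energy -/
  domain : Submodule ℝ (F → ℝ)
  /-- the energy form -/
  form : LinearMap.BilinForm ℝ domain
  const_mem : ∀ c : ℝ, (fun _ : F => c) ∈ domain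
  symm : ∀ f g : domain, form f g = form g f
  nonneg : ∀ f : domain, 0 ≤ form f f
  eq_zero_iff : ∀ f : domain, form f f = 0 ↔ ∃ c : ℝ, ∀ x, (f : F → ℝ) x = c
  /-- the space of functions modulo constants, with the energy form as inner product, is complete -/
  complete : ∀ w : ℕ → domain,
    (∀ ε : ℝ, 0 < ε → ∃ n₀, ∀ m ≥ n₀, ∀ n ≥ n₀, form (w m - w n) (w m - w n) < ε) →
    ∃ v : domain, Tendsto (fun n => form (w n - v) (w n - v)) atTop (𝓝 0)
  separates : ∀ x y : F, x ≠ y → ∃ f : domain, (f : F → ℝ) x ≠ (f : F → ℝ) y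
  bddAbove : ∀ x y : F, BddAbove {r : ℝ | ∃ f : domain, 0 < form f f ∧
    r = |(f : F → ℝ) x - (f : F → ℝ) y| ^ 2 / form f f}
  markov : ∀ f : domain, ∃ h : (fun x => max (min ((f : F → ℝ) x) 1) 0) ∈ domain,
    form ⟨_, h⟩ ⟨_, h⟩ ≤ form f f

namespace ResistanceForm

variable {F : Type u} (E : ResistanceForm F)

/-- The resistance metric associated with a resistance form:
`R(x, y) = sup { |f(x) - f(y)|² / E(f, f) : f ∈ domain, E(f, f) > 0 }`. -/
def resistance (x y : F) : ℝ :=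
  sSup {r : ℝ | ∃ f : E.domain, 0 < E.form f f ∧
    r = |(f : F → ℝ) x - (f : F → ℝ) y| ^ 2 / E.form f f}

theorem resistance_nonneg (x y : F) : 0 ≤ E.resistance x y := by
  apply Real.sSup_nonneg
  rintro r ⟨f, hf, rfl⟩
  positivity

theorem sq_le (x y : F) (f : E.domain) :
    ((f : F → ℝ) x - (f : F → ℝ) y) ^ 2 ≤ E.resistance x y * E.form f f := by
  rcases (E.nonneg f).lt_or_eq with h | h
  · rw [← div_le_iff₀ h, ← sq_abs]
    exact le_csSup (E.bddAbove x y) ⟨f, h, rfl⟩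
  · obtain ⟨c, hc⟩ := (E.eq_zero_iff f).1 h.symm
    simp [hc, ← h]

theorem resistance_le (x y : F) {C : ℝ} (hC : 0 ≤ C)
    (h : ∀ f : E.domain, ((f : F → ℝ) x - (f : F → ℝ) y) ^ 2 ≤ C * E.form f f) :
    E.resistance x y ≤ C := by
  apply Real.sSup_le _ hC
  rintro r ⟨f, hf, rfl⟩
  rw [div_le_iff₀ hf, sq_abs]
  exact h f

theorem resistance_self (x : F) : E.resistance x x = 0 :=
  le_antisymm (E.resistance_le x x le_rfl (by simp)) (E.resistance_nonneg x x)

theorem resistance_comm (x y : F) : E.resistance x y = E.resistance y x := by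
  unfold resistance
  simp_rw [abs_sub_comm]

theorem eq_of_resistance_eq_zero {x y : F} (h : E.resistance x y = 0) : x = y := by
  by_contra hxy
  obtain ⟨f, hf⟩ := E.separates x y hxy
  have := E.sq_le x y f
  rw [h, zero_mul] at this
  exact hf (sub_eq_zero.1 (pow_eq_zero_iff two_ne_zero |>.1 (le_antisymm this (sq_nonneg _))))

theorem markov_scaled (f : E.domain) {t : ℝ} (ht : 0 < t) :
    ∃ h : (fun x => max (min ((f : F → ℝ) x) t) 0) ∈ E.domain,
      E.form ⟨_, h⟩ ⟨_, h⟩ ≤ E.form f f := by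
  obtain ⟨h, hle⟩ := E.markov (t⁻¹ • f)
  set g : E.domain := ⟨_, h⟩ with hg
  have key : (fun x => max (min ((f : F → ℝ) x) t) 0) = ((t • g : E.domain) : F → ℝ) := by
    funext x
    simp only [hg, Submodule.coe_smul, Pi.smul_apply, smul_eq_mul]
    rw [mul_max_of_nonneg _ _ ht.le, mul_min_of_nonneg _ _ ht.le]
    field_simp
    simp
  have hmem : (fun x => max (min ((f : F → ℝ) x) t) 0) ∈ E.domain := by
    rw [key]; exact (t • g).2
  refine ⟨hmem, ?_⟩
  have : (⟨_, hmem⟩ : E.domain) = t • g := Subtype.ext key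
  rw [this]
  simp only [map_smul, LinearMap.smul_apply, smul_eq_mul] at hle ⊢
  have h2 : t * (t * E.form g g) ≤ t * (t * (t⁻¹ * (t⁻¹ * E.form f f))) := by gcongr
  refine h2.trans (le_of_eq ?_)
  field_simp

/-- Cutting a function at a level splits its energy superadditively. -/
theorem energy_split (f : E.domain) (hf0 : ∀ x, 0 ≤ (f : F → ℝ) x) {t : ℝ} (ht : 0 < t) :
    ∃ w v : E.domain, (∀ x, (w : F → ℝ) x = min ((f : F → ℝ) x) t) ∧
      (∀ x, (v : F → ℝ) x = (f : F → ℝ) x - min ((f : F → ℝ) x) t) ∧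
      E.form w w + E.form v v ≤ E.form f f := by
  obtain ⟨hw, -⟩ := E.markov_scaled f ht
  have hval : ∀ x, max (min ((f : F → ℝ) x) t) 0 = min ((f : F → ℝ) x) t := fun x =>
    max_eq_left (le_min (hf0 x) ht.le)
  let w : E.domain := ⟨_, hw⟩
  let v : E.domain := f - w
  have hwx : ∀ x, (w : F → ℝ) x = min ((f : F → ℝ) x) t := hval
  have hvx : ∀ x, (v : F → ℝ) x = (f : F → ℝ) x - min ((f : F → ℝ) x) t := by
    intro x
    change (f : F → ℝ) x - (w : F → ℝ) x = _
    rw [hwx]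
  refine ⟨w, v, hwx, hvx, ?_⟩
  have hle : ∀ l : ℝ, 0 < l → 0 ≤ 2 * E.form w v + l * E.form v v := by
    intro l hl
    obtain ⟨h1, h2⟩ := E.markov_scaled (w + l • v) ht
    have : (⟨_, h1⟩ : E.domain) = w := by
      apply Subtype.ext
      funext x
      simp only [Submodule.coe_add, Submodule.coe_smul, Pi.add_apply, Pi.smul_apply, smul_eq_mul,
        hwx, hvx]
      have h0 := hf0 x
      rcases le_total ((f : F → ℝ) x) t with hx | hx
      · simp [hx, h0]
      · have : 0 ≤ l * ((f : F → ℝ) x - t) := mul_nonneg hl.le (by linarith)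
        rw [min_eq_right hx, min_eq_right (by linarith), max_eq_left ht.le]
    rw [this] at h2
    simp only [map_add, map_smul, LinearMap.add_apply, LinearMap.smul_apply, smul_eq_mul,
      E.symm v w] at h2
    have h3 : 0 ≤ l * (2 * E.form w v + l * E.form v v) := by nlinarith
    exact nonneg_of_mul_nonneg_right h3 hl
  have hpos : 0 ≤ E.form w v := by
    by_contra hneg
    push Not at hneg
    have hv := E.nonneg v
    have h := hle (-(E.form w v) / (E.form v v + 1)) (div_pos (by linarith) (by linarith))
    have : -(E.form w v) / (E.form v v + 1) * E.form v v ≤ -(E.form w v) := by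
      rw [div_mul_eq_mul_div, div_le_iff₀ (by linarith)]
      nlinarith
    linarith
  have hfw : f = w + v := by simp [v]
  have : E.form f f = E.form w w + 2 * E.form w v + E.form v v := by
    rw [hfw]
    simp only [map_add, LinearMap.add_apply, E.symm v w]
    ring
  linarith

theorem resistance_triangle (x y z : F) :
    E.resistance x z ≤ E.resistance x y + E.resistance y z := by
  have hA := E.resistance_nonneg x y
  have hB := E.resistance_nonneg y z
  refine E.resistance_le x z (add_nonneg hA hB) fun f => ?_
  set d := (f : F → ℝ) x - (f : F → ℝ) z with hd
  rcases eq_or_ne d 0 with h0 | h0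
  · rw [h0]
    have := mul_nonneg (add_nonneg hA hB) (E.nonneg f)
    simpa using this
  let k : E.domain := ⟨fun _ => (f : F → ℝ) z, E.const_mem _⟩
  have hk : ∀ g : E.domain, E.form g k = 0 := by
    intro g
    have hkk : E.form k k = 0 := (E.eq_zero_iff k).2 ⟨_, fun _ => rfl⟩
    have hq : ∀ s : ℝ, 0 ≤ E.form g g + 2 * s * E.form g k := by
      intro s
      have := E.nonneg (g + s • k)
      simp only [map_add, map_smul, LinearMap.add_apply, LinearMap.smul_apply, smul_eq_mul,
        E.symm k g, hkk] at this
      linarith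
    by_contra hne
    have := hq (-(E.form g g + 1) / (2 * E.form g k))
    have h2 : 2 * (-(E.form g g + 1) / (2 * E.form g k)) * E.form g k = -(E.form g g + 1) := by
      field_simp
    linarith
  obtain ⟨h1, h2⟩ := E.markov (d⁻¹ • (f - k))
  set g : E.domain := ⟨_, h1⟩ with hg
  have hgle : d ^ 2 * E.form g g ≤ E.form f f := by
    have e : E.form (d⁻¹ • (f - k)) (d⁻¹ • (f - k)) = (d ^ 2)⁻¹ * E.form f f := by
      simp only [map_sub, map_smul, LinearMap.sub_apply, LinearMap.smul_apply, smul_eq_mul,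
        hk, E.symm k]
      field_simp
      ring
    rw [e] at h2
    have : 0 < d ^ 2 := by positivity
    rwa [inv_mul_eq_div, le_div_iff₀ this, mul_comm] at h2
  have hgx : (g : F → ℝ) x = 1 := by
    change max (min (d⁻¹ * ((f : F → ℝ) x - (f : F → ℝ) z)) 1) 0 = 1
    rw [← hd, inv_mul_cancel₀ h0]; simp
  have hgz : (g : F → ℝ) z = 0 := by
    change max (min (d⁻¹ * ((f : F → ℝ) z - (f : F → ℝ) z)) 1) 0 = 0
    simp
  have hg0 : ∀ p, 0 ≤ (g : F → ℝ) p := fun p => le_max_right _ _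
  have hg1 : ∀ p, (g : F → ℝ) p ≤ 1 := fun p => max_le (min_le_right _ _) zero_le_one
  have main : 1 ≤ (E.resistance x y + E.resistance y z) * E.form g g := by
    have hgn := E.nonneg g
    rcases (hg0 y).lt_or_eq with ht | ht
    · obtain ⟨w, v, hw, hv, hwv⟩ := E.energy_split g hg0 ht
      have a1 := E.sq_le y z w
      have a2 := E.sq_le x y v
      rw [hw, hw, hgz] at a1
      rw [hv, hv, hgx] at a2
      simp only [min_self, min_eq_left ht.le, min_eq_right (hg1 y), sub_zero, sub_self] at a1 a2
      have hwn := E.nonneg w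
      have hvn := E.nonneg v
      set t := (g : F → ℝ) y
      set A := E.resistance x y
      set B := E.resistance y z
      set p := E.form w w
      set q := E.form v v
      have hp : t * (1 - t) * (t * (1 - t)) ≤ (A * p) * (B * q) := by
        calc t * (1 - t) * (t * (1 - t)) = t ^ 2 * (1 - t) ^ 2 := by ring
          _ ≤ (B * p) * (A * q) := by gcongr
          _ = _ := by ring
      have hAp : 0 ≤ A * p := mul_nonneg hA hwn
      have hBq : 0 ≤ B * q := mul_nonneg hB hvn
      have ht2 : 2 * (t * (1 - t)) ≤ A * p + B * q := by
        by_contra hcon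
        push Not at hcon
        nlinarith [sq_nonneg (A * p - B * q)]
      have : (A + B) * (p + q) ≤ (A + B) * E.form g g := by gcongr
      nlinarith
    · have := E.sq_le x y g
      rw [hgx, ← ht] at this
      nlinarith [mul_nonneg hB hgn]
  have hAB := add_nonneg hA hB
  calc d ^ 2 = d ^ 2 * 1 := by ring
    _ ≤ d ^ 2 * ((E.resistance x y + E.resistance y z) * E.form g g) := by gcongr
    _ = (E.resistance x y + E.resistance y z) * (d ^ 2 * E.form g g) := by ring
    _ ≤ _ := by gcongr

/-- The metric space `(F, R)`. -/
@[reducible] def metricSpace : MetricSpace F where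
  dist := E.resistance
  dist_self := E.resistance_self
  dist_comm := E.resistance_comm
  dist_triangle := E.resistance_triangle
  eq_of_dist_eq_zero := E.eq_of_resistance_eq_zero

/-! ### Fusing -/

end ResistanceForm

/-- The equivalence relation generated by identifying, for each `i`, all points of `Γ i`. For
disjoint `Γ i` its classes are the `Γ i` and the remaining singletons. -/
def fuseSetoid {F : Type u} {ι : Type} (Γ : ι → Set F) : Setoid F :=
  Relation.EqvGen.setoid fun x y => ∃ i, x ∈ Γ i ∧ y ∈ Γ i

/-- The set `F^Γ`, in which each `Γ i` is collapsed to a point. -/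
def Fused {F : Type u} {ι : Type} (Γ : ι → Set F) : Type u := Quotient (fuseSetoid Γ)

/-- The canonical map `F → F^Γ`. -/
def fuseMap {F : Type u} {ι : Type} (Γ : ι → Set F) (x : F) : Fused Γ :=
  Quotient.mk (fuseSetoid Γ) x

theorem fuseMap_surjective {F : Type u} {ι : Type} (Γ : ι → Set F) :
    Function.Surjective (fuseMap Γ) := Quotient.mk_surjective

theorem fuseMap_eq_of_mem {F : Type u} {ι : Type} (Γ : ι → Set F) {i : ι} {x y : F}
    (hx : x ∈ Γ i) (hy : y ∈ Γ i) : fuseMap Γ x = fuseMap Γ y :=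
  Quotient.sound (Relation.EqvGen.rel _ _ ⟨i, hx, hy⟩)

theorem fuse_factor {F : Type u} {ι : Type} (Γ : ι → Set F) (g : F → ℝ)
    (hg : ∀ i, ∀ x ∈ Γ i, ∀ y ∈ Γ i, g x = g y) :
    ∃ f : Fused Γ → ℝ, ∀ x, f (fuseMap Γ x) = g x := by
  refine ⟨Quotient.lift g ?_, fun x => rfl⟩
  intro x y h
  induction (h : Relation.EqvGen _ x y) with
  | rel x y h => obtain ⟨i, hx, hy⟩ := h; exact hg i x hx y hy
  | refl x => rfl
  | symm x y _ ih => exact ih.symm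
  | trans x y z _ _ ih₁ ih₂ => exact ih₁.trans ih₂

namespace ResistanceForm

variable {F : Type u} (E : ResistanceForm F)

theorem exists_min (T : Finset F) (f g : E.domain) :
    ∃ h : E.domain, ∀ x ∈ T, (h : F → ℝ) x = min ((f : F → ℝ) x) ((g : F → ℝ) x) := by
  obtain ⟨M, hM⟩ := (T.finite_toSet.image fun x => (f : F → ℝ) x - (g : F → ℝ) x).bddAbove
  have hM' : ∀ x ∈ T, (f : F → ℝ) x - (g : F → ℝ) x ≤ max M 1 := fun x hx =>
    (hM ⟨x, hx, rfl⟩).trans (le_max_left _ _)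
  obtain ⟨h, -⟩ := E.markov_scaled (f - g) (t := max M 1) (by positivity)
  refine ⟨f - ⟨_, h⟩, fun x hx => ?_⟩
  simp only [Submodule.coe_sub, Pi.sub_apply]
  rw [min_eq_left (hM' x hx)]
  rcases le_total ((f : F → ℝ) x) ((g : F → ℝ) x) with h' | h'
  · rw [max_eq_right (by linarith), min_eq_left h']; ring
  · rw [max_eq_left (by linarith), min_eq_right h']; ring

theorem exists_bump (T : Finset F) (x : F) :
    ∃ h : E.domain, (h : F → ℝ) x = 1 ∧ ∀ y ∈ T, y ≠ x → (h : F → ℝ) y = 0 := by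
  classical
  suffices H : ∀ S : Finset F, x ∉ S → ∃ h : E.domain, (h : F → ℝ) x = 1 ∧
      (∀ y, 0 ≤ (h : F → ℝ) y ∨ y ∉ insert x (T ∪ S)) ∧ ∀ y ∈ S, (h : F → ℝ) y = 0 by
    obtain ⟨h, h1, -, h2⟩ := H (T.erase x) (by simp)
    exact ⟨h, h1, fun y hy hyx => h2 y (Finset.mem_erase.2 ⟨hyx, hy⟩)⟩
  intro S
  induction S using Finset.induction_on with
  | empty => exact fun _ => ⟨⟨_, E.const_mem 1⟩, rfl, fun y => Or.inl zero_le_one, by simp⟩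
  | insert y S hy ih =>
    intro hx
    simp only [Finset.mem_insert, not_or] at hx
    obtain ⟨h, h1, h2, h3⟩ := ih hx.2
    obtain ⟨f, hf⟩ := E.separates x y hx.1
    set d := (f : F → ℝ) x - (f : F → ℝ) y with hd
    have hd0 : d ≠ 0 := sub_ne_zero.2 hf
    let k : E.domain := ⟨fun _ => (f : F → ℝ) y, E.const_mem _⟩
    obtain ⟨hg, -⟩ := E.markov (d⁻¹ • (f - k))
    obtain ⟨hh, -⟩ := E.markov h
    obtain ⟨m, hm⟩ := E.exists_min (insert x (T ∪ insert y S)) ⟨_, hh⟩ ⟨_, hg⟩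
    have hgx : max (min (d⁻¹ * ((f : F → ℝ) x - (f : F → ℝ) y)) 1) 0 = 1 := by
      rw [← hd, inv_mul_cancel₀ hd0]; simp
    have hgy : max (min (d⁻¹ * ((f : F → ℝ) y - (f : F → ℝ) y)) 1) 0 = 0 := by simp
    refine ⟨m, ?_, fun z => ?_, fun z hz => ?_⟩
    · rw [hm x (by simp)]
      change min (max (min ((h : F → ℝ) x) 1) 0)
        (max (min (d⁻¹ * ((f : F → ℝ) x - (f : F → ℝ) y)) 1) 0) = 1
      rw [hgx, h1]; simp
    · by_cases hz : z ∈ insert x (T ∪ insert y S)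
      · left
        rw [hm z hz]
        exact le_min (le_max_right _ _) (le_max_right _ _)
      · exact Or.inr hz
    · rw [hm z (by simp only [Finset.mem_insert, Finset.mem_union] at hz ⊢; tauto)]
      change min (max (min ((h : F → ℝ) z) 1) 0)
        (max (min (d⁻¹ * ((f : F → ℝ) z - (f : F → ℝ) y)) 1) 0) = 0
      rcases Finset.mem_insert.1 hz with rfl | hz
      · rw [hgy]; exact min_eq_right (le_max_right _ _)
      · rw [h3 z hz]
        simp only [zero_le_one, min_eq_left, max_self]
        exact min_eq_left (le_max_right _ _)

theorem exists_interpolation (T : Finset F) (c : F → ℝ) :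
    ∃ h : E.domain, ∀ x ∈ T, (h : F → ℝ) x = c x := by
  classical
  choose b hb1 hb0 using fun x => E.exists_bump T x
  refine ⟨∑ y ∈ T, c y • b y, fun x hx => ?_⟩
  simp only [Submodule.coe_sum, Submodule.coe_smul, Finset.sum_apply, Pi.smul_apply, smul_eq_mul]
  rw [Finset.sum_eq_single x]
  · rw [hb1, mul_one]
  · intro y _ hyx
    rw [hb0 y x hx (Ne.symm hyx), mul_zero]
  · exact fun h => absurd hx h

variable {ι : Type} (Γ : ι → Set F)

/-- `{f : F^Γ → ℝ | f ∘ π^Γ ∈ domain}` -/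
def fuseDomain : Submodule ℝ (Fused Γ → ℝ) :=
  E.domain.comap (LinearMap.funLeft ℝ ℝ (fuseMap Γ))

/-- `f ↦ f ∘ π^Γ` -/
def fusePull : E.fuseDomain Γ →ₗ[ℝ] E.domain :=
  (LinearMap.funLeft ℝ ℝ (fuseMap Γ)).restrict fun _ h => h

theorem fusePull_apply (f : E.fuseDomain Γ) (x : F) :
    (E.fusePull Γ f : F → ℝ) x = (f : Fused Γ → ℝ) (fuseMap Γ x) := rfl

/-- The resistance form fused over a finite collection `Γ` of finite sets:
`E^Γ(f, g) = E(f ∘ π^Γ, g ∘ π^Γ)`. -/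
def fuse [Finite ι] (hΓ : ∀ i, (Γ i).Finite) : ResistanceForm (Fused Γ) where
  domain := E.fuseDomain Γ
  form := E.form.compl₁₂ (E.fusePull Γ) (E.fusePull Γ)
  const_mem c := E.const_mem c
  symm f g := E.symm _ _
  nonneg f := E.nonneg _
  eq_zero_iff f := by
    simp only [LinearMap.compl₁₂_apply]
    rw [E.eq_zero_iff]
    simp only [fusePull_apply]
    exact exists_congr fun c => ((fuseMap_surjective Γ).forall (p := fun p => f.1 p = c)).symm
  complete w hw := by
    have hform : ∀ f g : E.fuseDomain Γ, (E.form.compl₁₂ (E.fusePull Γ) (E.fusePull Γ)) (f - g)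
        (f - g) = E.form (E.fusePull Γ f - E.fusePull Γ g) (E.fusePull Γ f - E.fusePull Γ g) := by
      intro f g
      rw [LinearMap.compl₁₂_apply, map_sub]
    simp only [hform] at hw ⊢
    obtain ⟨v, hv⟩ := E.complete (fun n => E.fusePull Γ (w n)) hw
    have hconv : ∀ x y : F, fuseMap Γ x = fuseMap Γ y → (v : F → ℝ) x = (v : F → ℝ) y := by
      intro x y hxy
      have h1 : ∀ n, ((v : F → ℝ) x - (v : F → ℝ) y) ^ 2 ≤ E.resistance x y *
          E.form (E.fusePull Γ (w n) - v) (E.fusePull Γ (w n) - v) := by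
        intro n
        have := E.sq_le x y (E.fusePull Γ (w n) - v)
        simp only [Submodule.coe_sub, Pi.sub_apply, fusePull_apply, hxy] at this
        refine le_trans (le_of_eq ?_) this
        ring
      have h2 := ge_of_tendsto' (hv.const_mul (E.resistance x y)) h1
      rw [mul_zero] at h2
      exact sub_eq_zero.1 (pow_eq_zero_iff two_ne_zero |>.1 (le_antisymm h2 (sq_nonneg _)))
    obtain ⟨f, hf⟩ := fuse_factor Γ (v : F → ℝ) fun i x hx y hy =>
      hconv x y (fuseMap_eq_of_mem Γ hx hy)
    have hfv : (fun x => f (fuseMap Γ x)) = (v : F → ℝ) := funext hf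
    have hmem : f ∈ E.fuseDomain Γ := by
      change (fun x => f (fuseMap Γ x)) ∈ E.domain
      rw [hfv]; exact v.2
    refine ⟨⟨f, hmem⟩, ?_⟩
    have : E.fusePull Γ ⟨f, hmem⟩ = v := Subtype.ext hfv
    simpa only [this] using hv
  separates p q hpq := by
    classical
    obtain ⟨x, rfl⟩ := fuseMap_surjective Γ p
    obtain ⟨y, rfl⟩ := fuseMap_surjective Γ q
    have hfin : ((⋃ i, Γ i) ∪ {x, y}).Finite :=
      (Set.finite_iUnion hΓ).union (Set.toFinite _)
    obtain ⟨h, hh⟩ := E.exists_interpolation hfin.toFinset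
      fun z => if fuseMap Γ z = fuseMap Γ x then 1 else 0
    have hh' : ∀ z ∈ (⋃ i, Γ i) ∪ {x, y}, (h : F → ℝ) z =
        if fuseMap Γ z = fuseMap Γ x then 1 else 0 := fun z hz => hh z (hfin.mem_toFinset.2 hz)
    obtain ⟨f, hf⟩ := fuse_factor Γ (h : F → ℝ) fun i a ha b hb => by
      rw [hh' a (Or.inl (Set.mem_iUnion.2 ⟨i, ha⟩)), hh' b (Or.inl (Set.mem_iUnion.2 ⟨i, hb⟩)),
        fuseMap_eq_of_mem Γ ha hb]
    have hfh : (fun z => f (fuseMap Γ z)) = (h : F → ℝ) := funext hf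
    have hmem : f ∈ E.fuseDomain Γ := by
      change (fun z => f (fuseMap Γ z)) ∈ E.domain
      rw [hfh]; exact h.2
    refine ⟨⟨f, hmem⟩, ?_⟩
    change f (fuseMap Γ x) ≠ f (fuseMap Γ y)
    rw [hf, hf, hh' x (by simp), hh' y (by simp)]
    simp [Ne.symm hpq]
  bddAbove p q := by
    obtain ⟨x, rfl⟩ := fuseMap_surjective Γ p
    obtain ⟨y, rfl⟩ := fuseMap_surjective Γ q
    refine (E.bddAbove x y).mono ?_
    rintro r ⟨f, hf, rfl⟩
    exact ⟨E.fusePull Γ f, hf, rfl⟩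
  markov f := E.markov (E.fusePull Γ f)

/-- The canonical map is a contraction. -/
theorem fuse_resistance_le [Finite ι] (hΓ : ∀ i, (Γ i).Finite) (x y : F) :
    (E.fuse Γ hΓ).resistance (fuseMap Γ x) (fuseMap Γ y) ≤ E.resistance x y :=
  (E.fuse Γ hΓ).resistance_le _ _ (E.resistance_nonneg x y) fun f =>
    E.sq_le x y (E.fusePull Γ f)

theorem fuse_continuous [MetricSpace F] (hE : ∀ x y, E.resistance x y = dist x y) [Finite ι]
    (hΓ : ∀ i, (Γ i).Finite) :
    letI := (E.fuse Γ hΓ).metricSpace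
    Continuous (fuseMap Γ) := by
  let := (E.fuse Γ hΓ).metricSpace
  have : LipschitzWith 1 (fuseMap Γ) := LipschitzWith.of_dist_le_mul fun x y => by
    rw [NNReal.coe_one, one_mul, ← hE]
    exact E.fuse_resistance_le Γ hΓ x y
  exact this.continuous

theorem fuse_compactSpace [MetricSpace F] [CompactSpace F]
    (hE : ∀ x y, E.resistance x y = dist x y) [Finite ι] (hΓ : ∀ i, (Γ i).Finite) :
    letI := (E.fuse Γ hΓ).metricSpace
    CompactSpace (Fused Γ) := by
  let := (E.fuse Γ hΓ).metricSpace
  exact (fuseMap_surjective Γ).compactSpace (E.fuse_continuous Γ hE hΓ)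

end ResistanceForm

/-! ### Electrical networks -/

/-- An electrical network with finite vertex set `V`: a connected simple graph with a symmetric
conductance that is positive exactly on the edges. -/
structure ElectricalNetwork (V : Type u) [Fintype V] where
  graph : SimpleGraph V
  connected : graph.Connected
  /-- the conductance -/
  cond : V → V → ℝ
  cond_nonneg : ∀ x y, 0 ≤ cond x y
  cond_symm : ∀ x y, cond x y = cond y x
  cond_pos_iff : ∀ x y, 0 < cond x y ↔ graph.Adj x y

namespace ElectricalNetwork

variable {V : Type u} [Fintype V] (G : ElectricalNetwork V)

/-- The total conductance at a vertex. -/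
def totalCond (x : V) : ℝ≥0 := ∑ y, ⟨G.cond x y, G.cond_nonneg x y⟩

/-- `E_G(f, g) = ½ ∑_{x, y} μ_G(x, y) (f(x) - f(y)) (g(x) - g(y))` -/
def energy : LinearMap.BilinForm ℝ (V → ℝ) :=
  LinearMap.mk₂ ℝ
    (fun f g => (1 / 2 : ℝ) * ∑ x, ∑ y, G.cond x y * (f x - f y) * (g x - g y))
    (fun f f' g => by
      rw [← mul_add, ← Finset.sum_add_distrib]
      simp_rw [← Finset.sum_add_distrib]
      refine congrArg _ (Finset.sum_congr rfl fun x _ => Finset.sum_congr rfl fun y _ => ?_)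
      simp only [Pi.add_apply]; ring)
    (fun c f g => by
      rw [smul_eq_mul, mul_left_comm, Finset.mul_sum]
      simp_rw [Finset.mul_sum]
      refine Finset.sum_congr rfl fun x _ => Finset.sum_congr rfl fun y _ => ?_
      simp only [Pi.smul_apply, smul_eq_mul]; ring)
    (fun f g g' => by
      rw [← mul_add, ← Finset.sum_add_distrib]
      simp_rw [← Finset.sum_add_distrib]
      refine congrArg _ (Finset.sum_congr rfl fun x _ => Finset.sum_congr rfl fun y _ => ?_)
      simp only [Pi.add_apply]; ring)
    (fun c f g => by
      rw [smul_eq_mul, mul_left_comm, Finset.mul_sum]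
      simp_rw [Finset.mul_sum]
      refine Finset.sum_congr rfl fun x _ => Finset.sum_congr rfl fun y _ => ?_
      simp only [Pi.smul_apply, smul_eq_mul]; ring)

theorem energy_apply (f g : V → ℝ) :
    G.energy f g = (1 / 2 : ℝ) * ∑ x, ∑ y, G.cond x y * (f x - f y) * (g x - g y) := rfl

theorem energy_term_nonneg (f : V → ℝ) (x y : V) :
    0 ≤ G.cond x y * (f x - f y) * (f x - f y) := by
  rw [mul_assoc]
  exact mul_nonneg (G.cond_nonneg x y) (mul_self_nonneg _)

theorem energy_nonneg (f : V → ℝ) : 0 ≤ G.energy f f := by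
  rw [energy_apply]
  exact mul_nonneg (by norm_num)
    (Finset.sum_nonneg fun x _ => Finset.sum_nonneg fun y _ => G.energy_term_nonneg f x y)

theorem energy_edge (f : V → ℝ) (x y : V) :
    G.cond x y * (f x - f y) ^ 2 ≤ 2 * G.energy f f := by
  rw [energy_apply]
  have h1 : G.cond x y * (f x - f y) * (f x - f y) ≤
      ∑ y, G.cond x y * (f x - f y) * (f x - f y) :=
    Finset.single_le_sum (f := fun y => G.cond x y * (f x - f y) * (f x - f y))
      (fun y _ => G.energy_term_nonneg f x y) (Finset.mem_univ y)
  have h2 : ∑ y, G.cond x y * (f x - f y) * (f x - f y) ≤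
      ∑ x, ∑ y, G.cond x y * (f x - f y) * (f x - f y) :=
    Finset.single_le_sum (f := fun x => ∑ y, G.cond x y * (f x - f y) * (f x - f y))
      (fun x _ => Finset.sum_nonneg fun y _ => G.energy_term_nonneg f x y) (Finset.mem_univ x)
  nlinarith

theorem energy_bound (x y : V) :
    ∃ C : ℝ, 0 ≤ C ∧ ∀ f : V → ℝ, (f x - f y) ^ 2 ≤ C * G.energy f f := by
  obtain ⟨p⟩ := G.connected.preconnected x y
  induction p with
  | nil => exact ⟨0, le_rfl, by simp⟩
  | @cons x z y h p ih =>
    obtain ⟨C, hC, hf⟩ := ih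
    have hc := (G.cond_pos_iff x z).2 h
    refine ⟨2 * (2 / G.cond x z) + 2 * C, by positivity, fun f => ?_⟩
    have h1 : (f x - f z) ^ 2 ≤ 2 / G.cond x z * G.energy f f := by
      rw [div_mul_eq_mul_div, le_div_iff₀ hc, mul_comm]
      exact G.energy_edge f x z
    have h2 := hf f
    nlinarith [sq_nonneg ((f x - f z) - (f z - f y))]

/-- The resistance form of an electrical network; every function on the finite set `V` has finite
energy. -/
def resistanceForm : ResistanceForm V where
  domain := ⊤
  form := G.energy.compl₁₂ (Submodule.subtype ⊤) (Submodule.subtype ⊤)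
  const_mem _ := Submodule.mem_top
  symm f g := by
    simp only [LinearMap.compl₁₂_apply, energy_apply]
    refine congrArg _ (Finset.sum_congr rfl fun x _ => Finset.sum_congr rfl fun y _ => ?_)
    ring
  nonneg f := G.energy_nonneg _
  eq_zero_iff f := by
    simp only [LinearMap.compl₁₂_apply, Submodule.subtype_apply]
    constructor
    · intro h
      obtain ⟨x₀⟩ := G.connected.nonempty
      refine ⟨f.1 x₀, fun x => ?_⟩
      obtain ⟨C, _, hf⟩ := G.energy_bound x x₀
      have := hf f.1
      rw [h, mul_zero] at this
      exact sub_eq_zero.1 (pow_eq_zero_iff two_ne_zero |>.1 (le_antisymm this (sq_nonneg _)))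
    · rintro ⟨c, hc⟩
      simp [energy_apply, hc]
  complete w hw := by
    simp only [LinearMap.compl₁₂_apply, Submodule.subtype_apply, Submodule.coe_sub] at hw ⊢
    obtain ⟨x₀⟩ := G.connected.nonempty
    have hlim : ∀ x, ∃ l, Tendsto (fun n => (w n).1 x - (w n).1 x₀) atTop (𝓝 l) := by
      intro x
      obtain ⟨C, hC, hf⟩ := G.energy_bound x x₀
      apply cauchySeq_tendsto_of_complete
      rw [Metric.cauchySeq_iff]
      intro ε hε
      obtain ⟨n₀, hn₀⟩ := hw (ε ^ 2 / (C + 1)) (by positivity)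
      refine ⟨n₀, fun m hm n hn => ?_⟩
      have h1 := hf ((w m).1 - (w n).1)
      have h2 := hn₀ m hm n hn
      rw [lt_div_iff₀ (by positivity)] at h2
      simp only [Pi.sub_apply] at h1
      rw [Real.dist_eq]
      apply abs_lt_of_sq_lt_sq _ hε.le
      have h3 := G.energy_nonneg ((w m).1 - (w n).1)
      calc _ = ((w m).1 x - (w n).1 x - ((w m).1 x₀ - (w n).1 x₀)) ^ 2 := by ring
        _ ≤ _ := h1
        _ ≤ G.energy ((w m).1 - (w n).1) ((w m).1 - (w n).1) * (C + 1) := by nlinarith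
        _ < _ := h2
    choose l hl using hlim
    refine ⟨⟨l, Submodule.mem_top⟩, ?_⟩
    simp only [energy_apply, Pi.sub_apply]
    have : Tendsto (fun n => (1 / 2 : ℝ) * ∑ x, ∑ y, G.cond x y *
        (((w n).1 x - (w n).1 x₀ - l x) - ((w n).1 y - (w n).1 x₀ - l y)) *
        (((w n).1 x - (w n).1 x₀ - l x) - ((w n).1 y - (w n).1 x₀ - l y))) atTop
        (𝓝 ((1 / 2 : ℝ) * ∑ x, ∑ y, G.cond x y * ((l x - l x) - (l y - l y)) *
          ((l x - l x) - (l y - l y)))) := by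
      refine Tendsto.const_mul _ (tendsto_finsetSum _ fun x _ => tendsto_finsetSum _ fun y _ => ?_)
      have h := ((hl x).sub_const (l x)).sub ((hl y).sub_const (l y))
      exact (h.const_mul _).mul h
    simp only [sub_self, mul_zero, Finset.sum_const_zero] at this
    refine this.congr fun n => ?_
    refine congrArg _ (Finset.sum_congr rfl fun x _ => Finset.sum_congr rfl fun y _ => ?_)
    ring
  separates x y hxy := by
    classical
    exact ⟨⟨Pi.single x 1, Submodule.mem_top⟩, by simp [Pi.single_eq_of_ne (Ne.symm hxy)]⟩
  bddAbove x y := by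
    obtain ⟨C, _, hf⟩ := G.energy_bound x y
    refine ⟨C, ?_⟩
    rintro r ⟨f, h, rfl⟩
    rw [div_le_iff₀ h, sq_abs]
    exact hf f.1
  markov f := by
    refine ⟨Submodule.mem_top, ?_⟩
    simp only [LinearMap.compl₁₂_apply, Submodule.subtype_apply, energy_apply]
    refine mul_le_mul_of_nonneg_left (Finset.sum_le_sum fun x _ => Finset.sum_le_sum fun y _ => ?_)
      (by norm_num)
    rw [mul_assoc, mul_assoc]
    refine mul_le_mul_of_nonneg_left ?_ (G.cond_nonneg x y)
    rw [← abs_mul_abs_self, ← abs_mul_abs_self (f.1 x - f.1 y)]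
    have : |max (min (f.1 x) 1) 0 - max (min (f.1 y) 1) 0| ≤ |f.1 x - f.1 y| :=
      (abs_max_sub_max_le_abs _ _ _).trans (abs_inf_sub_inf_le_abs _ _ _)
    exact mul_self_le_mul_self (abs_nonneg _) this

open Classical in
/-- The network obtained by attaching a new unit-conductance edge between `a i` and `b i` for each
`i`; if there was an edge already, its conductance is increased by one. -/
def addEdges {N : ℕ} (a b : Fin N → V) (hab : ∀ i, a i ≠ b i) : ElectricalNetwork V where
  graph := G.graph ⊔ SimpleGraph.fromEdgeSet {e | ∃ i, e = s(a i, b i)}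
  connected := G.connected.mono le_sup_left
  cond x y := if ∃ i, s(x, y) = s(a i, b i) then G.cond x y + 1 else G.cond x y
  cond_nonneg x y := by
    have := G.cond_nonneg x y
    split_ifs <;> linarith
  cond_symm x y := by rw [Sym2.eq_swap, G.cond_symm x y]
  cond_pos_iff x y := by
    simp only [SimpleGraph.sup_adj, SimpleGraph.fromEdgeSet_adj, Set.mem_ofPred_eq]
    split_ifs with h
    · have h0 := G.cond_nonneg x y
      refine iff_of_true (by linarith) (Or.inr ⟨h, ?_⟩)
      rintro rfl
      obtain ⟨i, hi⟩ := h
      rcases Sym2.eq_iff.1 hi with ⟨h1, h2⟩ | ⟨h1, h2⟩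
      · exact hab i (h1.symm.trans h2)
      · exact hab i (h2.symm.trans h1)
    · rw [G.cond_pos_iff]
      tauto

end ElectricalNetwork

/-! ### Spaces of rooted compact metric spaces -/

/-- A rooted compact metric space. -/
structure RootedCompact : Type (u + 1) where
  carrier : Type u
  [metric : MetricSpace carrier]
  [compact : CompactSpace carrier]
  [meas : MeasurableSpace carrier]
  [borel : BorelSpace carrier]
  root : carrier

attribute [instance] RootedCompact.metric RootedCompact.compact RootedCompact.meas
  RootedCompact.borel

/-- A representative of an element of the space `𝔐_c(M_fin(· × ℝ₊) × P^ι)`: a rooted compact metric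
space `S` with a finite Borel measure on `S × ℝ₊` and a family of points of `S` indexed by `ι`. For
empty `ι` these are the elements of `𝔐_c(M_fin(· × ℝ₊))`. -/
structure MarkedSpace (ι : Type) : Type (u + 1) extends RootedCompact.{u} where
  measure : Measure (carrier × ℝ≥0)
  [finite : IsFiniteMeasure measure]
  point : ι → carrier

namespace MarkedSpace

variable {ι : Type}

/-- A root-and-distance-preserving map. -/
structure RootedEmbedding (S T : RootedCompact.{u}) where
  toFun : S.carrier → T.carrier
  isometry : Isometry toFun
  map_root : toFun S.root = T.root

/-- The Gromov-Hausdorff-type distance: the infimum over all rooted compact metric spaces `M` and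
root-and-distance-preserving maps `f : S → M`, `g : T → M` of the maximum of the Hausdorff distance
of the images, the Prohorov distance of the pushforward measures on `M × ℝ₊` (with the maximum
metric) and the distances of the images of the marked points. -/
def gromovDist (S T : MarkedSpace.{u} ι) : ℝ≥0∞ :=
  ⨅ (M : RootedCompact.{u}) (f : RootedEmbedding S.toRootedCompact M)
    (g : RootedEmbedding T.toRootedCompact M),
    max (Metric.hausdorffEDist (Set.range f.toFun) (Set.range g.toFun))
      (max (levyProkhorovEDist (S.measure.map (Prod.map f.toFun id))
          (T.measure.map (Prod.map g.toFun id)))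
        (⨆ i, edist (f.toFun (S.point i)) (g.toFun (T.point i))))

/-- Convergence of a sequence with respect to the Gromov-Hausdorff-type distance. -/
def ConvergesTo (S : ℕ → MarkedSpace.{u} ι) (T : MarkedSpace.{u} ι) : Prop :=
  Tendsto (fun n => gromovDist (S n) T) atTop (𝓝 0)

end MarkedSpace

/-- The metric `c · d`, for `c > 0`. -/
@[reducible] def scaledMetric {X : Type u} (m : MetricSpace X) (c : ℝ) (hc : 0 < c) :
    MetricSpace X where
  dist x y := c * m.dist x y
  dist_self x := by simp
  dist_comm x y := by rw [m.dist_comm]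
  dist_triangle x y z := by
    rw [← mul_add]
    exact mul_le_mul_of_nonneg_left (m.dist_triangle x y z) hc.le
  eq_of_dist_eq_zero {x y} h :=
    m.eq_of_dist_eq_zero ((mul_eq_zero.1 h).resolve_left hc.ne')

/-- The marked space `(V_G, α⁻¹ R_G, ρ, β⁻¹ μ̇_G, p)`, where `μ̇_G` is the pushforward of the counting
measure on `V_G` under `x ↦ (x, μ_G(x))`. -/
def ElectricalNetwork.markedSpace {V : Type u} [Fintype V] (G : ElectricalNetwork V)
    (α β : ℝ) (hα : 0 < α) (ρ : V) {ι : Type} (p : ι → V) : MarkedSpace.{u} ι :=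
  letI : MetricSpace V := scaledMetric G.resistanceForm.metricSpace α⁻¹ (inv_pos.2 hα)
  letI : MeasurableSpace V := borel V
  haveI : BorelSpace V := ⟨rfl⟩
  haveI : IsFiniteMeasure (ENNReal.ofReal β⁻¹ •
      (Measure.count : Measure V).map (fun x => (x, G.totalCond x))) :=
    Measure.smul_finite _ ENNReal.ofReal_ne_top
  { carrier := V
    root := ρ
    measure := ENNReal.ofReal β⁻¹ •
      (Measure.count : Measure V).map (fun x => (x, G.totalCond x))
    point := p }

/-- The marked space `(F, R, ρ, μ̇, p)`. -/
def limitSpace (F : Type u) [MetricSpace F] [CompactSpace F] [MeasurableSpace F] [BorelSpace F]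
    (ρ : F) (μ : Measure (F × ℝ≥0)) [IsFiniteMeasure μ] {ι : Type} (p : ι → F) :
    MarkedSpace.{u} ι where
  carrier := F
  root := ρ
  measure := μ
  point := p

/-- The marked space `(F^Γ, R^Γ, π(ρ), μ̇ ∘ (π × id)⁻¹)`, where `(F^Γ, R^Γ)` is the compact resistance
metric space `(F, R)` fused over `Γ` and `π` is the canonical map. -/
def fusedSpace {F : Type u} [MetricSpace F] [CompactSpace F] [MeasurableSpace F] [BorelSpace F]
    (E : ResistanceForm F) (hE : ∀ x y, E.resistance x y = dist x y)
    (ρ : F) (μ : Measure (F × ℝ≥0)) [IsFiniteMeasure μ]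
    {κ : Type} [Finite κ] (Γ : κ → Set F) (hΓ : ∀ i, (Γ i).Finite) : MarkedSpace.{u} Empty :=
  letI : MetricSpace (Fused Γ) := (E.fuse Γ hΓ).metricSpace
  haveI : CompactSpace (Fused Γ) := E.fuse_compactSpace Γ hE hΓ
  letI : MeasurableSpace (Fused Γ) := borel (Fused Γ)
  haveI : BorelSpace (Fused Γ) := ⟨rfl⟩
  { carrier := Fused Γ
    root := fuseMap Γ ρ
    measure := μ.map (Prod.map (fuseMap Γ) id)
    point := Empty.elim }

end

/-!
The metric part of the convergence reduces to a statement about finitely many resistances. In a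
resistance form every functional `f ↦ f x - f y` is represented by a potential
(`ResistanceForm.exists_isPotential`), and polarization expresses the inner products of these
potentials in terms of the resistance metric. Hence the squared norm of the functional
`f ↦ f x - f y - ∑ i, θ i * (f (a i) - f (b i))` is an explicit quadratic polynomial in `θ`, here
called `flowEnergy`, whose coefficients are linear in the resistances between the points `x`, `y`,
`a i` and `b i`.

By Thomson's principle, the fused resistance between `x` and `y` is the minimum of `flowEnergy` over
`θ` (the currents that enter at `a i` and leave at `b i` come for free), and the resistance in a
network with additional unit edges is the minimum of `flowEnergy` plus `∑ i, θ i ^ 2`, the energy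
dissipated in the new edges. After rescaling, the coefficients of the two polynomials are close, and
the additional term has the small factor `(α n)⁻¹`. As the points `a i`, `b i` of the limit are
distinct, the quadratic part of the limiting polynomial is positive definite
(`ResistanceForm.exists_sq_sum_abs_le`), so all minimizers are bounded and the minima are close,
uniformly in `x` and `y`: this is `ResistanceForm.exists_abs_addEdges_resistance_sub_le`.

A common embedding of the original spaces yields a correspondence between their points, for which
the new metrics have small distortion, and a correspondence of small distortion yields a common
embedding of the new spaces that preserves roots (`RootedCompact.exists_embeddings`). Prohorov
distances are carried along (`levyProkhorovEDist_le_of_edist_lt`): the conductance measure changes at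
no more than `2 N` vertices, that is, by a mass of at most `2 N / β n`.
-/

/-! ### Potentials of a resistance form -/

/-- The Riesz representation theorem for a complete positive definite symmetric bilinear form. -/
theorem exists_riesz {W : Type*} [AddCommGroup W] [Module ℝ W] (B : LinearMap.BilinForm ℝ W)
    (hsymm : ∀ f g, B f g = B g f) (hnonneg : ∀ f, 0 ≤ B f f) (hdef : ∀ f, B f f = 0 → f = 0)
    (hcomplete : ∀ w : ℕ → W,
      (∀ ε : ℝ, 0 < ε → ∃ n₀, ∀ m ≥ n₀, ∀ n ≥ n₀, B (w m - w n) (w m - w n) < ε) →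
      ∃ v : W, Tendsto (fun n => B (w n - v) (w n - v)) atTop (𝓝 0))
    (L : W →ₗ[ℝ] ℝ) (C : ℝ) (hL : ∀ f, L f ^ 2 ≤ C * B f f) : ∃ g, ∀ f, B g f = L f := by
  let core : InnerProductSpace.Core ℝ W :=
    { inner := fun f g => B f g
      conj_inner_symm := fun f g => hsymm g f
      re_inner_nonneg := hnonneg
      add_left := fun f g h => by simp
      smul_left := fun f g r => by simp
      definite := hdef }
  let : NormedAddCommGroup W := core.toNormedAddCommGroup
  let : InnerProductSpace ℝ W := InnerProductSpace.ofCore core.toCore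
  have hinner : ∀ f g : W, inner ℝ f g = B f g := fun _ _ => rfl
  have hnorm : ∀ f : W, ‖f‖ ^ 2 = B f f := fun f => by
    rw [← real_inner_self_eq_norm_sq, hinner]
  have : CompleteSpace W := by
    refine Metric.complete_of_cauchySeq_tendsto fun w hw => ?_
    obtain ⟨v, hv⟩ := hcomplete w fun ε hε => by
      obtain ⟨n₀, h⟩ := Metric.cauchySeq_iff.1 hw (√ε) (Real.sqrt_pos.2 hε)
      refine ⟨n₀, fun m hm n hn => ?_⟩
      have h1 := h m hm n hn
      rwa [dist_eq_norm, Real.lt_sqrt (norm_nonneg _), hnorm] at h1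
    refine ⟨v, tendsto_iff_norm_sub_tendsto_zero.2 ?_⟩
    have h2 := hv.sqrt
    rw [Real.sqrt_zero] at h2
    refine h2.congr fun n => ?_
    rw [← hnorm, Real.sqrt_sq (norm_nonneg _)]
  let L' : StrongDual ℝ W := L.mkContinuous (√|C|) fun f => by
    rw [Real.norm_eq_abs, ← Real.sqrt_sq (norm_nonneg f), ← Real.sqrt_mul (abs_nonneg _), hnorm]
    exact Real.abs_le_sqrt ((hL f).trans
      (mul_le_mul_of_nonneg_right (le_abs_self C) (hnonneg f)))
  refine ⟨(InnerProductSpace.toDual ℝ W).symm L', fun f => ?_⟩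
  rw [← hinner]
  exact InnerProductSpace.toDual_symm_apply

namespace ResistanceForm

variable {F : Type u} (E : ResistanceForm F)

theorem form_sq_le (f g : E.domain) : E.form f g ^ 2 ≤ E.form f f * E.form g g :=
  E.form.apply_sq_le_of_symm E.nonneg ⟨E.symm⟩ f g

theorem form_eq_zero_of_const (g k : E.domain) (hk : ∃ c : ℝ, ∀ x, (k : F → ℝ) x = c) :
    E.form g k = 0 := by
  have h := E.form_sq_le g k
  rw [(E.eq_zero_iff k).2 hk, mul_zero] at h
  exact pow_eq_zero_iff two_ne_zero |>.1 (le_antisymm h (sq_nonneg _))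

/-- The Riesz representation theorem for evaluation at `x`, on functions vanishing at `o`. -/
theorem exists_form_eq_eval (o x : F) :
    ∃ g : E.domain, ∀ f : E.domain, (f : F → ℝ) o = 0 → E.form g f = (f : F → ℝ) x := by
  let W : Submodule ℝ E.domain :=
    { carrier := {f | (f : F → ℝ) o = 0}
      add_mem' := fun {f g} hf hg => by
        change (f : F → ℝ) o + (g : F → ℝ) o = 0
        rw [show (f : F → ℝ) o = 0 from hf, show (g : F → ℝ) o = 0 from hg, add_zero]
      zero_mem' := rfl
      smul_mem' := fun c f hf => by
        change c * (f : F → ℝ) o = 0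
        rw [show (f : F → ℝ) o = 0 from hf, mul_zero] }
  let L : W →ₗ[ℝ] ℝ :=
    { toFun := fun f => (f.1 : F → ℝ) x
      map_add' := fun _ _ => rfl
      map_smul' := fun _ _ => rfl }
  have hdef : ∀ f : W, E.form f f = 0 → f = 0 := fun f hf => by
    obtain ⟨c, hc⟩ := (E.eq_zero_iff f.1).1 hf
    ext z
    change (f.1 : F → ℝ) z = 0
    rw [hc z, ← hc o]
    exact f.2
  have hcomplete : ∀ w : ℕ → W, (∀ ε : ℝ, 0 < ε → ∃ n₀, ∀ m ≥ n₀, ∀ n ≥ n₀,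
      E.form (w m - w n) (w m - w n) < ε) →
      ∃ v : W, Tendsto (fun n => E.form (w n - v) (w n - v)) atTop (𝓝 0) := fun w hw => by
    obtain ⟨v, hv⟩ := E.complete (fun n => (w n : E.domain)) hw
    -- The limit is determined up to a constant, which is chosen so that it vanishes at `o`.
    let k : E.domain := ⟨fun _ => (v : F → ℝ) o, E.const_mem _⟩
    have hk : ∀ g : E.domain, E.form (g + k) (g + k) = E.form g g := fun g => by
      have h1 := E.form_eq_zero_of_const g k ⟨_, fun _ => rfl⟩
      have h2 := E.form_eq_zero_of_const k k ⟨_, fun _ => rfl⟩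
      simp [h1, h2, E.symm k g]
    refine ⟨⟨v - k, sub_self ((v : F → ℝ) o)⟩, hv.congr fun n => ?_⟩
    rw [← hk, sub_add]
  have hL : ∀ f : W, L f ^ 2 ≤ E.resistance x o * E.form f f := fun f => by
    have h := E.sq_le x o f.1
    rwa [show (f.1 : F → ℝ) o = 0 from f.2, sub_zero] at h
  let B : LinearMap.BilinForm ℝ W := E.form.compl₁₂ W.subtype W.subtype
  obtain ⟨g, hg⟩ := exists_riesz (W := W) B (fun f g => E.symm _ _) (fun f => E.nonneg _) hdef
    hcomplete L (E.resistance x o) hL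
  exact ⟨g, fun f hf => hg ⟨f, hf⟩⟩

/-- A family `p : F → domain` is a family of potentials if `p x - p y` represents the functional
`f ↦ f x - f y`. -/
def IsPotential (p : F → E.domain) : Prop :=
  ∀ x y, ∀ f : E.domain, E.form (p x - p y) f = (f : F → ℝ) x - (f : F → ℝ) y

theorem exists_isPotential : ∃ p : F → E.domain, E.IsPotential p := by
  rcases isEmpty_or_nonempty F with hF | ⟨⟨o⟩⟩
  · exact ⟨fun x => isEmptyElim x, fun x => isEmptyElim x⟩
  choose p hp using E.exists_form_eq_eval o
  refine ⟨p, fun x y f => ?_⟩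
  let k : E.domain := ⟨fun _ => (f : F → ℝ) o, E.const_mem _⟩
  have hk : ∀ z, E.form (p z) f = (f : F → ℝ) z - (f : F → ℝ) o := fun z => by
    have h1 := hp z (f - k) (by change (f : F → ℝ) o - (f : F → ℝ) o = 0; simp)
    rw [map_sub, E.form_eq_zero_of_const _ k ⟨_, fun _ => rfl⟩, sub_zero] at h1
    exact h1
  rw [map_sub, LinearMap.sub_apply, hk, hk]
  ring

/-- The resistance is the energy of the function representing `f ↦ f x - f y`. -/
theorem resistance_eq_form {x y : F} {g : E.domain}
    (hg : ∀ f : E.domain, E.form g f = (f : F → ℝ) x - (f : F → ℝ) y) :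
    E.resistance x y = E.form g g := by
  refine le_antisymm (E.resistance_le x y (E.nonneg g) fun f => ?_) ?_
  · rw [← hg]
    exact E.form_sq_le g f
  · have h := E.sq_le x y g
    rw [← hg, sq] at h
    rcases (E.nonneg g).lt_or_eq with h0 | h0
    · exact le_of_mul_le_mul_right h h0
    · rw [← h0]
      exact E.resistance_nonneg x y

end ResistanceForm

/-! ### The energy of a flow in terms of the resistance metric -/

/-- The inner product of the unit flows from `x` to `y` and from `z` to `w`, written in terms of the
resistance metric by polarization. -/
noncomputable def mutualEnergy {X : Type*} (R : X → X → ℝ) (x y z w : X) : ℝ :=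
  (R x w + R y z - R x z - R y w) / 2

/-- The energy of the minimal flow that injects a unit current at `x`, extracts it at `y`, and
carries for each `i` an additional current `-θ i` from `a i` to `b i`, written in terms of the
resistance metric. -/
noncomputable def flowEnergy {X : Type*} {N : ℕ} (R : X → X → ℝ) (x y : X) (a b : Fin N → X)
    (θ : Fin N → ℝ) : ℝ :=
  mutualEnergy R x y x y - 2 * ∑ i, θ i * mutualEnergy R x y (a i) (b i) +
    ∑ i, ∑ j, θ i * θ j * mutualEnergy R (a i) (b i) (a j) (b j)

theorem abs_mutualEnergy_sub_le {X Y : Type*} {R : X → X → ℝ} {S : Y → Y → ℝ} {C : X → Y → Prop}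
    {η : ℝ} (h : ∀ x x' y y', C x y → C x' y' → |R x x' - S y y'| ≤ η) {x₁ x₂ x₃ x₄ : X}
    {y₁ y₂ y₃ y₄ : Y} (h₁ : C x₁ y₁) (h₂ : C x₂ y₂) (h₃ : C x₃ y₃) (h₄ : C x₄ y₄) :
    |mutualEnergy R x₁ x₂ x₃ x₄ - mutualEnergy S y₁ y₂ y₃ y₄| ≤ 2 * η := by
  have e1 := abs_le.1 (h _ _ _ _ h₁ h₄)
  have e2 := abs_le.1 (h _ _ _ _ h₂ h₃)
  have e3 := abs_le.1 (h _ _ _ _ h₁ h₃)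
  have e4 := abs_le.1 (h _ _ _ _ h₂ h₄)
  unfold mutualEnergy
  exact abs_le.2 ⟨by linarith [e1.1, e2.1, e3.2, e4.2], by linarith [e1.2, e2.2, e3.1, e4.1]⟩

theorem abs_flowEnergy_sub_le {X Y : Type*} {N : ℕ} {R : X → X → ℝ} {S : Y → Y → ℝ}
    {C : X → Y → Prop} {η : ℝ} (h : ∀ x x' y y', C x y → C x' y' → |R x x' - S y y'| ≤ η)
    {x x' : X} {y y' : Y} (hx : C x y) (hx' : C x' y') {a b : Fin N → X} {a' b' : Fin N → Y}
    (ha : ∀ i, C (a i) (a' i)) (hb : ∀ i, C (b i) (b' i)) (θ : Fin N → ℝ) :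
    |flowEnergy R x x' a b θ - flowEnergy S y y' a' b' θ| ≤ 2 * η * (1 + ∑ i, |θ i|) ^ 2 := by
  have e0 := abs_mutualEnergy_sub_le h hx hx' hx hx'
  have e1 : |∑ i, θ i * mutualEnergy R x x' (a i) (b i) -
      ∑ i, θ i * mutualEnergy S y y' (a' i) (b' i)| ≤ 2 * η * ∑ i, |θ i| := by
    rw [← Finset.sum_sub_distrib, Finset.mul_sum]
    refine (Finset.abs_sum_le_sum_abs _ _).trans (Finset.sum_le_sum fun i _ => ?_)
    rw [← mul_sub, abs_mul, mul_comm]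
    exact mul_le_mul_of_nonneg_right (abs_mutualEnergy_sub_le h hx hx' (ha i) (hb i)) (abs_nonneg _)
  have e2 : |∑ i, ∑ j, θ i * θ j * mutualEnergy R (a i) (b i) (a j) (b j) -
      ∑ i, ∑ j, θ i * θ j * mutualEnergy S (a' i) (b' i) (a' j) (b' j)| ≤
      2 * η * (∑ i, |θ i|) ^ 2 := by
    rw [← Finset.sum_sub_distrib, sq, Finset.sum_mul_sum, Finset.mul_sum]
    refine (Finset.abs_sum_le_sum_abs _ _).trans (Finset.sum_le_sum fun i _ => ?_)
    rw [← Finset.sum_sub_distrib, Finset.mul_sum]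
    refine (Finset.abs_sum_le_sum_abs _ _).trans (Finset.sum_le_sum fun j _ => ?_)
    rw [← mul_sub, abs_mul, abs_mul, mul_comm]
    exact mul_le_mul_of_nonneg_right (abs_mutualEnergy_sub_le h (ha i) (hb i) (ha j) (hb j))
      (mul_nonneg (abs_nonneg _) (abs_nonneg _))
  rw [abs_le] at e0 e1 e2 ⊢
  unfold flowEnergy
  constructor <;> nlinarith [e0.1, e0.2, e1.1, e1.2, e2.1, e2.2]

theorem flowEnergy_const_mul {X : Type*} {N : ℕ} (c : ℝ) (R : X → X → ℝ) (x y : X)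
    (a b : Fin N → X) (θ : Fin N → ℝ) :
    flowEnergy (fun x y => c * R x y) x y a b θ = c * flowEnergy R x y a b θ := by
  have h : ∀ x y z w, mutualEnergy (fun x y => c * R x y) x y z w = c * mutualEnergy R x y z w :=
    fun x y z w => by unfold mutualEnergy; ring
  simp only [flowEnergy, h, mul_left_comm _ c, ← Finset.mul_sum]
  ring

namespace ResistanceForm

variable {F : Type u} (E : ResistanceForm F) {p : F → E.domain}

variable {E} in
theorem IsPotential.form_eq_mutualEnergy (hp : E.IsPotential p) (x y z w : F) :
    E.form (p x - p y) (p z - p w) = mutualEnergy E.resistance x y z w := by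
  have hR : ∀ s t, E.resistance s t = E.form (p s - p t) (p s - p t) := fun s t =>
    E.resistance_eq_form (hp s t)
  simp only [mutualEnergy, hR, map_sub, LinearMap.sub_apply]
  rw [E.symm (p w) (p x), E.symm (p z) (p y), E.symm (p z) (p x), E.symm (p w) (p y)]
  ring

/-- The potential of the flow whose energy is `flowEnergy`. -/
noncomputable def flowPotential {N : ℕ} (p : F → E.domain) (x y : F) (a b : Fin N → F)
    (θ : Fin N → ℝ) : E.domain :=
  p x - p y - ∑ i, θ i • (p (a i) - p (b i))

variable {N : ℕ} (x y : F) (a b : Fin N → F) (θ : Fin N → ℝ)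

variable {E} in
theorem IsPotential.form_flowPotential (hp : E.IsPotential p) (f : E.domain) :
    E.form (E.flowPotential p x y a b θ) f = (f : F → ℝ) x - (f : F → ℝ) y -
      ∑ i, θ i * ((f : F → ℝ) (a i) - (f : F → ℝ) (b i)) := by
  rw [flowPotential, map_sub, LinearMap.sub_apply, hp, map_sum, LinearMap.sum_apply]
  simp only [map_smul, LinearMap.smul_apply, smul_eq_mul, hp _ _ f]

variable {E} in
theorem IsPotential.form_flowPotential_self (hp : E.IsPotential p) :
    E.form (E.flowPotential p x y a b θ) (E.flowPotential p x y a b θ) =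
      flowEnergy E.resistance x y a b θ := by
  have h : ∀ (u : E.domain) (ψ : Fin N → E.domain),
      E.form (u - ∑ i, θ i • ψ i) (u - ∑ i, θ i • ψ i) = E.form u u - 2 * ∑ i, θ i * E.form u (ψ i) +
        ∑ i, ∑ j, θ i * θ j * E.form (ψ i) (ψ j) := fun u ψ => by
    simp only [LinearMap.BilinForm.sub_left, LinearMap.BilinForm.sub_right,
      LinearMap.BilinForm.sum_left, LinearMap.BilinForm.sum_right,
      LinearMap.BilinForm.smul_left, LinearMap.BilinForm.smul_right, mul_assoc, E.symm _ u,
      mul_sub, Finset.sum_sub_distrib, ← Finset.mul_sum, fun i j => E.symm (ψ j) (ψ i)]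
    ring
  rw [flowPotential, h]
  simp only [hp.form_eq_mutualEnergy]
  rfl

/-- A function representing `f ↦ f x - f y - ∑ θ i (f (a i) - f (b i))` has energy `flowEnergy`. -/
theorem form_eq_flowEnergy {g : E.domain} (hg : ∀ f : E.domain, E.form g f = (f : F → ℝ) x -
    (f : F → ℝ) y - ∑ i, θ i * ((f : F → ℝ) (a i) - (f : F → ℝ) (b i))) :
    E.form g g = flowEnergy E.resistance x y a b θ := by
  obtain ⟨p, hp⟩ := E.exists_isPotential
  set h := E.flowPotential p x y a b θ with hh
  have e : ∀ f, E.form g f = E.form h f := fun f => by rw [hg, hp.form_flowPotential]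
  rw [← hp.form_flowPotential_self, ← hh, e g, E.symm, e h]

/-- The bound dual to `flowEnergy`. -/
theorem sq_le_flowEnergy_mul (f : E.domain) :
    ((f : F → ℝ) x - (f : F → ℝ) y - ∑ i, θ i * ((f : F → ℝ) (a i) - (f : F → ℝ) (b i))) ^ 2 ≤
      flowEnergy E.resistance x y a b θ * E.form f f := by
  obtain ⟨p, hp⟩ := E.exists_isPotential
  rw [← hp.form_flowPotential, ← hp.form_flowPotential_self]
  exact E.form_sq_le _ _

theorem flowEnergy_nonneg : 0 ≤ flowEnergy E.resistance x y a b θ := by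
  obtain ⟨p, hp⟩ := E.exists_isPotential
  rw [← hp.form_flowPotential_self]
  exact E.nonneg _

/-! ### Thomson's principle for fused forms and for networks with additional edges -/

/-- One half of Thomson's principle for the fused form. -/
theorem fuse_resistance_le_flowEnergy :
    (E.fuse (fun i => {a i, b i}) (fun _ => Set.toFinite _)).resistance
      (fuseMap _ x) (fuseMap _ y) ≤ flowEnergy E.resistance x y a b θ := by
  refine resistance_le _ _ _ (E.flowEnergy_nonneg _ _ _ _ _) fun f => ?_
  have h := E.sq_le_flowEnergy_mul x y a b θ (E.fusePull _ f)
  have h0 : ∀ i, (E.fusePull _ f : F → ℝ) (a i) - (E.fusePull _ f : F → ℝ) (b i) = 0 := fun i =>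
    sub_eq_zero.2 (congrArg f.1 (fuseMap_eq_of_mem _ (i := i) (by simp) (by simp)))
  simp only [h0, mul_zero, Finset.sum_const_zero, sub_zero] at h
  exact h

/-- The other half of Thomson's principle for the fused form: the resistance is attained by a flow.
The potential in the fused form differs from that in the original form by a functional that kills
all functions with `f (a i) = f (b i)`, hence by a combination of the functionals
`f ↦ f (a i) - f (b i)`. -/
theorem exists_flowEnergy_eq_fuse_resistance :
    ∃ θ : Fin N → ℝ, flowEnergy E.resistance x y a b θ =
      (E.fuse (fun i => {a i, b i}) (fun _ => Set.toFinite _)).resistance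
        (fuseMap _ x) (fuseMap _ y) := by
  set Γ : Fin N → Set F := fun i => {a i, b i} with hΓ
  set E' := E.fuse Γ (fun _ => Set.toFinite _) with hE'
  obtain ⟨q, hq⟩ := E'.exists_isPotential
  set g : E'.domain := q (fuseMap Γ x) - q (fuseMap Γ y) with hg
  let D : F → F → E.domain →ₗ[ℝ] ℝ := fun x y =>
    { toFun := fun f => (f : F → ℝ) x - (f : F → ℝ) y
      map_add' := fun f h => by simp only [Submodule.coe_add, Pi.add_apply]; ring
      map_smul' := fun c f => by
        simp only [Submodule.coe_smul, Pi.smul_apply, smul_eq_mul, RingHom.id_apply]; ring }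
  have hspan : D x y - E.form (E.fusePull Γ g) ∈
      Submodule.span ℝ (Set.range fun i => D (a i) (b i)) := by
    refine mem_span_of_iInf_ker_le_ker fun f hf => ?_
    simp only [Submodule.mem_iInf, LinearMap.mem_ker] at hf
    have hf' : ∀ i, (f : F → ℝ) (a i) = (f : F → ℝ) (b i) := fun i => sub_eq_zero.1 (hf i)
    obtain ⟨f', hf'⟩ := fuse_factor Γ (f : F → ℝ) fun i s hs t ht => by
      rcases hs with rfl | rfl <;> rcases ht with rfl | rfl <;> simp [hf']
    have hcomp : (fun s => f' (fuseMap Γ s)) = (f : F → ℝ) := funext hf'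
    have hmem : f' ∈ E'.domain := by
      change (fun s => f' (fuseMap Γ s)) ∈ E.domain
      rw [hcomp]; exact f.2
    have h1 := hq (fuseMap Γ x) (fuseMap Γ y) ⟨f', hmem⟩
    have h2 : E.fusePull Γ ⟨f', hmem⟩ = f := Subtype.ext hcomp
    rw [LinearMap.mem_ker, LinearMap.sub_apply, sub_eq_zero, ← h2]
    exact h1.symm
  obtain ⟨θ, hθ⟩ := Submodule.mem_span_range_iff_exists_fun ℝ |>.1 hspan
  refine ⟨θ, ?_⟩
  rw [E'.resistance_eq_form (hq _ _)]
  change _ = E.form (E.fusePull Γ g) (E.fusePull Γ g)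
  refine (E.form_eq_flowEnergy x y a b θ fun f => ?_).symm
  have h := LinearMap.congr_fun hθ f
  simp only [LinearMap.sum_apply, LinearMap.smul_apply, smul_eq_mul, LinearMap.sub_apply] at h
  change ∑ i, θ i * ((f : F → ℝ) (a i) - (f : F → ℝ) (b i)) =
    (f : F → ℝ) x - (f : F → ℝ) y - E.form (E.fusePull Γ g) f at h
  linarith

end ResistanceForm

namespace ElectricalNetwork

variable {V : Type u} [Fintype V] (G : ElectricalNetwork V) {N : ℕ} {a b : Fin N → V}

theorem addEdges_cond (hab : ∀ i, a i ≠ b i) (hpairs : Function.Injective fun i => s(a i, b i))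
    [DecidableEq V] (x y : V) : (G.addEdges a b hab).cond x y = G.cond x y +
      ∑ i, ((if x = a i ∧ y = b i then 1 else 0) + (if x = b i ∧ y = a i then 1 else 0)) := by
  have h1 : ∀ i, ((if x = a i ∧ y = b i then 1 else 0) + (if x = b i ∧ y = a i then 1 else 0) : ℝ)
      = if s(x, y) = s(a i, b i) then 1 else 0 := fun i => by
    have := hab i
    simp only [Sym2.eq_iff]
    split_ifs <;> grind
  simp only [h1]
  unfold addEdges
  dsimp only
  split_ifs with h
  · obtain ⟨i, hi⟩ := h
    rw [Finset.sum_eq_single i, if_pos hi]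
    · intro j _ hji
      rw [if_neg fun hj => hji (hpairs (hj.symm.trans hi))]
    · simp
  · rw [Finset.sum_eq_zero, add_zero]
    intro i _
    exact if_neg fun hi => h ⟨i, hi⟩

theorem addEdges_energy (hab : ∀ i, a i ≠ b i) (hpairs : Function.Injective fun i => s(a i, b i))
    (f g : V → ℝ) : (G.addEdges a b hab).energy f g = G.energy f g +
      ∑ i, (f (a i) - f (b i)) * (g (a i) - g (b i)) := by
  classical
  have key : ∀ s t : V, ∑ x, ∑ y, (if x = s ∧ y = t then (1 : ℝ) else 0) * (f x - f y) * (g x - g y)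
      = (f s - f t) * (g s - g t) := fun s t => by
    rw [Finset.sum_eq_single s, Finset.sum_eq_single t]
    · simp
    · intro y _ hy; simp [hy]
    · simp
    · intro x _ hx; simp [hx]
    · simp
  simp only [energy_apply, G.addEdges_cond hab hpairs, add_mul, Finset.sum_add_distrib, mul_add,
    Finset.sum_mul]
  have h1 : ∀ H : Fin N → V → V → ℝ, ∑ x, ∑ y, ∑ i, H i x y = ∑ i, ∑ x, ∑ y, H i x y := fun H => by
    rw [Finset.sum_comm]
    simp only [Finset.sum_comm (s := (Finset.univ : Finset V)) (t := (Finset.univ : Finset (Fin N)))]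
    exact Finset.sum_congr rfl fun i _ => Finset.sum_comm
  rw [h1, h1]
  simp only [key]
  have h2 : ∀ i, (f (b i) - f (a i)) * (g (b i) - g (a i)) =
      (f (a i) - f (b i)) * (g (a i) - g (b i)) := fun i => by ring
  simp only [h2]
  ring

/-- One half of Thomson's principle for the network with additional edges, in which a current `θ i`
through the `i`-th new edge dissipates the energy `θ i ^ 2`. -/
theorem addEdges_resistance_le_flowEnergy (hab : ∀ i, a i ≠ b i)
    (hpairs : Function.Injective fun i => s(a i, b i)) (x y : V) (θ : Fin N → ℝ) :
    (G.addEdges a b hab).resistanceForm.resistance x y ≤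
      flowEnergy G.resistanceForm.resistance x y a b θ + ∑ i, θ i ^ 2 := by
  have hA := G.resistanceForm.flowEnergy_nonneg x y a b θ
  have hB : 0 ≤ ∑ i, θ i ^ 2 := Finset.sum_nonneg fun i _ => sq_nonneg _
  refine ResistanceForm.resistance_le _ _ _ (add_nonneg hA hB) fun f => ?_
  have h1 : (G.addEdges a b hab).resistanceForm.form f f = G.resistanceForm.form ⟨f.1, trivial⟩
      ⟨f.1, trivial⟩ + ∑ i, (f.1 (a i) - f.1 (b i)) ^ 2 := by
    simp only [sq]
    exact G.addEdges_energy hab hpairs f.1 f.1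
  have h2 := G.resistanceForm.sq_le_flowEnergy_mul x y a b θ ⟨f.1, trivial⟩
  have h3 := Finset.sum_mul_sq_le_sq_mul_sq Finset.univ θ fun i => f.1 (a i) - f.1 (b i)
  have hC := G.resistanceForm.nonneg ⟨f.1, trivial⟩
  have hD : 0 ≤ ∑ i, (f.1 (a i) - f.1 (b i)) ^ 2 := Finset.sum_nonneg fun i _ => sq_nonneg _
  rw [h1]
  set A := flowEnergy G.resistanceForm.resistance x y a b θ
  set B := ∑ i, θ i ^ 2
  set C := G.resistanceForm.form ⟨f.1, trivial⟩ ⟨f.1, trivial⟩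
  set D := ∑ i, (f.1 (a i) - f.1 (b i)) ^ 2
  set Q := ∑ i, θ i * (f.1 (a i) - f.1 (b i))
  set P := f.1 x - f.1 y - Q with hP
  have hPQ : f.1 x - f.1 y = P + Q := by rw [hP]; ring
  rw [hPQ]
  have h4 : 2 * (P * Q) ≤ A * D + B * C := by
    have h5 : (P * Q) ^ 2 ≤ (A * D) * (B * C) := by
      calc (P * Q) ^ 2 = P ^ 2 * Q ^ 2 := by ring
        _ ≤ (A * C) * (B * D) := by gcongr
        _ = _ := by ring
    have h6 := mul_nonneg hA hD
    have h7 := mul_nonneg hB hC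
    by_contra hcon
    push Not at hcon
    nlinarith [sq_nonneg (A * D - B * C)]
  change P ^ 2 ≤ A * C at h2
  nlinarith

/-- The other half of Thomson's principle for the network with additional edges: the resistance is
attained at the currents that the potential in the larger network drives through the new edges. -/
theorem exists_flowEnergy_eq_addEdges_resistance (hab : ∀ i, a i ≠ b i)
    (hpairs : Function.Injective fun i => s(a i, b i)) (x y : V) :
    ∃ θ : Fin N → ℝ, flowEnergy G.resistanceForm.resistance x y a b θ + ∑ i, θ i ^ 2 =
      (G.addEdges a b hab).resistanceForm.resistance x y := by
  obtain ⟨q, hq⟩ := (G.addEdges a b hab).resistanceForm.exists_isPotential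
  set g := q x - q y with hg
  have h1 : ∀ f : V → ℝ, G.energy g.1 f + ∑ i, (g.1 (a i) - g.1 (b i)) * (f (a i) - f (b i)) =
      f x - f y := fun f =>
    (G.addEdges_energy hab hpairs g.1 f).symm.trans (hq x y ⟨f, trivial⟩)
  refine ⟨fun i => g.1 (a i) - g.1 (b i), ?_⟩
  rw [(G.addEdges a b hab).resistanceForm.resistance_eq_form (hq x y)]
  have h2 := G.resistanceForm.form_eq_flowEnergy x y a b (fun i => g.1 (a i) - g.1 (b i))
    (g := ⟨g.1, trivial⟩) fun f => by
      have := h1 f.1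
      change G.energy g.1 f.1 = _
      linarith
  rw [← h2]
  simp only [sq]
  exact (G.addEdges_energy hab hpairs g.1 g.1).symm

end ElectricalNetwork

/-! ### Comparison of the network with additional edges and the fused form -/

namespace ResistanceForm

variable {F : Type u} (E : ResistanceForm F) {N : ℕ} {a b : Fin N → F}

/-- The currents in `flowEnergy` are controlled by the energy. The `j`-th current is read off from a
test function that is `1` at `a j` and `0` at all other `a i` and `b i`. -/
theorem exists_sq_sum_abs_le (hab : Function.Injective (Sum.elim a b)) :
    ∃ S : ℝ, 0 ≤ S ∧ ∀ x y (θ : Fin N → ℝ),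
      (∑ i, |θ i|) ^ 2 ≤ S * (E.resistance x y + flowEnergy E.resistance x y a b θ) := by
  classical
  have hf : ∀ j, ∃ f : E.domain, (∀ i, (f : F → ℝ) (a i) = if i = j then 1 else 0) ∧
      ∀ i, (f : F → ℝ) (b i) = 0 := fun j => by
    obtain ⟨f, hf⟩ := E.exists_interpolation (Finset.univ.image (Sum.elim a b))
      fun z => if z = a j then 1 else 0
    refine ⟨f, fun i => ?_, fun i => ?_⟩
    · rw [hf (a i) (Finset.mem_image.2 ⟨Sum.inl i, by simp, rfl⟩)]
      have : a i = a j ↔ i = j := ⟨fun h => Sum.inl_injective (hab h), fun h => h ▸ rfl⟩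
      simp [this]
    · rw [hf (b i) (Finset.mem_image.2 ⟨Sum.inr i, by simp, rfl⟩), if_neg]
      exact fun h => Sum.inr_ne_inl (hab (a₁ := Sum.inr i) (a₂ := Sum.inl j) h)
  choose f hfa hfb using hf
  refine ⟨N * ∑ j, 2 * E.form (f j) (f j), mul_nonneg (Nat.cast_nonneg _)
    (Finset.sum_nonneg fun j _ => mul_nonneg zero_le_two (E.nonneg _)), fun x y θ => ?_⟩
  have h1 : ∀ j, |θ j| ^ 2 ≤
      2 * E.form (f j) (f j) * (E.resistance x y + flowEnergy E.resistance x y a b θ) := fun j => by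
    have e1 := E.sq_le x y (f j)
    have e2 := E.sq_le_flowEnergy_mul x y a b θ (f j)
    simp only [hfa, hfb, sub_zero, mul_ite, mul_one, mul_zero, Finset.sum_ite_eq',
      Finset.mem_univ, if_true] at e2
    rw [sq_abs]
    nlinarith [sq_nonneg (((f j : F → ℝ) x - (f j : F → ℝ) y) * 2 - θ j)]
  calc (∑ i, |θ i|) ^ 2 ≤ N * ∑ j, |θ j| ^ 2 := by
        simpa using sq_sum_le_card_mul_sum_sq (s := Finset.univ) (f := fun i => |θ i|)
    _ ≤ N * ∑ j, 2 * E.form (f j) (f j) *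
        (E.resistance x y + flowEnergy E.resistance x y a b θ) := by
        gcongr with j
        exact h1 j
    _ = _ := by rw [← Finset.sum_mul, mul_assoc]

/-- If the rescaled resistance metric of a network is close to that of `E`, and the rescaled
resistance `c` of a unit edge is small, then the rescaled resistance metric of the network with
additional edges is close to that of the fused form. Both resistances are minima over the currents
through the edges to be added or contracted; the minimizers are bounded, and on bounded sets of
currents the functions to be minimized are close. -/
theorem exists_abs_addEdges_resistance_sub_le (hinj : Function.Injective (Sum.elim a b)) {D : ℝ}
    (hD : ∀ x y, E.resistance x y ≤ D) {ε : ℝ} (hε : 0 < ε) :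
    ∃ η : ℝ, 0 < η ∧ ∀ (V : Type u) [Fintype V] (G : ElectricalNetwork V) (a' b' : Fin N → V)
      (hab : ∀ i, a' i ≠ b' i) (_ : Function.Injective fun i => s(a' i, b' i)) (c : ℝ)
      (_ : 0 ≤ c) (_ : c ≤ η) (C : V → F → Prop)
      (_ : ∀ x x' y y', C x y → C x' y' →
        |c * G.resistanceForm.resistance x x' - E.resistance y y'| ≤ η)
      (_ : ∀ i, C (a' i) (a i)) (_ : ∀ i, C (b' i) (b i)), ∀ x x' y y', C x y → C x' y' →
        |c * (G.addEdges a' b' hab).resistanceForm.resistance x x' -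
          (E.fuse (fun i => {a i, b i}) (fun _ => Set.toFinite _)).resistance
            (fuseMap _ y) (fuseMap _ y')| ≤ ε := by
  obtain ⟨S, hS0, hS⟩ := E.exists_sq_sum_abs_le hinj
  rcases isEmpty_or_nonempty F with hF | ⟨⟨o⟩⟩
  · exact ⟨1, one_pos, fun _ _ _ _ _ _ _ _ _ _ _ _ _ _ _ _ y => isEmptyElim y⟩
  have hD0 : 0 ≤ D := (E.resistance_nonneg o o).trans (hD o o)
  -- `K` collects the bounds on the minimizers `θ` and makes the error in either direction `η * K`;
  -- the second bound on `η` absorbs the quadratic error term when the minimizer for the network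
  -- is estimated.
  set K := 4 + 10 * (S * D) + 8 * S * (2 * D + 5) with hK
  have hK0 : 0 < K := by positivity
  refine ⟨min 1 (min (1 / (8 * (S + 1))) (ε / K)), by positivity,
    fun V _ G a' b' hab hpairs c hc0 hc C hC ha hb x x' y y' hxy hxy' => ?_⟩
  set η := min 1 (min (1 / (8 * (S + 1))) (ε / K)) with hη
  have hη0 : 0 < η := by positivity
  have hη1 : η ≤ 1 := min_le_left _ _
  have hη2 : S * η ≤ 1 / 8 := by
    have h1 : η ≤ 1 / (8 * (S + 1)) := (min_le_right _ _).trans (min_le_left _ _)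
    rw [le_div_iff₀ (by positivity)] at h1
    nlinarith
  have hη3 : η * K ≤ ε := (le_div_iff₀ hK0).1 ((min_le_right _ _).trans (min_le_right _ _))
  have hclose : ∀ θ, |c * flowEnergy G.resistanceForm.resistance x x' a' b' θ -
      flowEnergy E.resistance y y' a b θ| ≤ 2 * η * (1 + ∑ i, |θ i|) ^ 2 := fun θ => by
    rw [← flowEnergy_const_mul]
    exact abs_flowEnergy_sub_le hC hxy hxy' ha hb θ
  have hSD : 0 ≤ S * D := mul_nonneg hS0 hD0
  rw [abs_le]
  constructor
  · obtain ⟨θ, hθ⟩ := G.exists_flowEnergy_eq_addEdges_resistance hab hpairs x x'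
    have e1 := E.fuse_resistance_le_flowEnergy y y' a b θ
    have e2 := abs_le.1 (hclose θ)
    have e3 := hS y y' θ
    have e4 := hD y y'
    have e5 := abs_le.1 (hC _ _ _ _ hxy hxy')
    -- Taking `θ = 0` shows that additional edges decrease the resistance.
    have e6 : c * (G.addEdges a' b' hab).resistanceForm.resistance x x' ≤
        c * G.resistanceForm.resistance x x' := by
      have := G.addEdges_resistance_le_flowEnergy hab hpairs x x' 0
      simp only [flowEnergy, mutualEnergy, Pi.zero_apply, zero_mul, zero_pow two_ne_zero,
        Finset.sum_const_zero,
        ResistanceForm.resistance_self, G.resistanceForm.resistance_comm x' x] at this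
      exact mul_le_mul_of_nonneg_left (by linarith) hc0
    have e7 : c * flowEnergy G.resistanceForm.resistance x x' a' b' θ ≤
        c * (G.addEdges a' b' hab).resistanceForm.resistance x x' := by
      rw [← hθ]
      exact mul_le_mul_of_nonneg_left
        (le_add_of_nonneg_right (Finset.sum_nonneg fun i _ => sq_nonneg _)) hc0
    set s := ∑ i, |θ i|
    set q := flowEnergy E.resistance y y' a b θ
    have e8 : (1 + s) ^ 2 ≤ 2 + 2 * s ^ 2 := by nlinarith [sq_nonneg (s - 1)]
    have e9 : 2 * η * (1 + s) ^ 2 ≤ 2 * η * (2 + 2 * s ^ 2) := by gcongr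
    have e10 : q ≤ D + 5 * η + 4 * η * s ^ 2 := by linarith [e2.1, e5.2]
    have e11 : s ^ 2 ≤ S * (2 * D + 5) + s ^ 2 / 2 := by
      calc s ^ 2 ≤ S * (E.resistance y y' + q) := e3
        _ ≤ S * (D + (D + 5 * 1 + 4 * η * s ^ 2)) := by gcongr; linarith
        _ = S * (2 * D + 5) + 4 * (S * η) * s ^ 2 := by ring
        _ ≤ S * (2 * D + 5) + 4 * (1 / 8) * s ^ 2 := by gcongr
        _ = _ := by ring
    have e12 : 2 * η * (2 + 2 * s ^ 2) ≤ ε := by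
      refine le_trans ?_ hη3
      rw [hK, show 2 * η * (2 + 2 * s ^ 2) = η * (4 + 4 * s ^ 2) by ring]
      exact mul_le_mul_of_nonneg_left (by linarith) hη0.le
    linarith [e2.1]
  · obtain ⟨θ, hθ⟩ := E.exists_flowEnergy_eq_fuse_resistance y y' a b
    have e1 := mul_le_mul_of_nonneg_left (G.addEdges_resistance_le_flowEnergy hab hpairs x x' θ) hc0
    have e2 := abs_le.1 (hclose θ)
    have e3 := hS y y' θ
    have e4 := hD y y'
    have e5 := E.fuse_resistance_le (fun i => {a i, b i}) (fun _ => Set.toFinite _) y y'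
    have e6 : ∑ i, θ i ^ 2 ≤ (∑ i, |θ i|) ^ 2 := by
      simpa using Finset.sum_sq_le_sq_sum_of_nonneg (s := Finset.univ) (f := fun i => |θ i|)
        fun i _ => abs_nonneg _
    rw [mul_add] at e1
    rw [hθ] at e2 e3
    set s := ∑ i, |θ i|
    have e7 : s ^ 2 ≤ 2 * (S * D) := by
      refine e3.trans ?_
      calc _ ≤ S * (D + D) := by gcongr; exact e5.trans e4
        _ = _ := by ring
    have e8 : (1 + s) ^ 2 ≤ 2 + 2 * s ^ 2 := by nlinarith [sq_nonneg (s - 1)]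
    have e9 : 2 * η * (1 + s) ^ 2 ≤ 2 * η * (2 + 2 * s ^ 2) := by gcongr
    have e10 : c * ∑ i, θ i ^ 2 ≤ η * s ^ 2 :=
      mul_le_mul hc e6 (Finset.sum_nonneg fun i _ => sq_nonneg _) hη0.le
    have e11 : 2 * η * (2 + 2 * s ^ 2) + η * s ^ 2 ≤ ε := by
      refine le_trans ?_ hη3
      rw [hK, show 2 * η * (2 + 2 * s ^ 2) + η * s ^ 2 = η * (4 + 5 * s ^ 2) by ring]
      exact mul_le_mul_of_nonneg_left (by linarith) hη0.le
    linarith [e2.2]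

end ResistanceForm

/-! ### Embeddings and Prohorov distances from correspondences -/

/-- Two rooted compact metric spaces with a correspondence of distortion at most `δ` that contains
the pair of roots embed, preserving roots, into a space where corresponding points have distance at
most `2 δ`. The embeddings are `x ↦ (dist x ·) - dist root ·` on the left and right components of
the points of the correspondence, in the supremum norm. -/
theorem RootedCompact.exists_embeddings (S T : RootedCompact.{u}) (C : S.carrier → T.carrier → Prop)
    (hS : ∀ x, ∃ y, C x y) (hT : ∀ y, ∃ x, C x y) (hroot : C S.root T.root) {δ : ℝ}
    (hδ : ∀ x x' y y', C x y → C x' y' → |dist x x' - dist y y'| ≤ δ) :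
    ∃ (M : RootedCompact.{u}) (f : MarkedSpace.RootedEmbedding S M)
      (g : MarkedSpace.RootedEmbedding T M), ∀ x y, C x y → dist (f.toFun x) (g.toFun y) ≤ 2 * δ := by
  let I := {p : S.carrier × T.carrier // C p.1 p.2}
  have hδ0 : 0 ≤ δ := (abs_nonneg _).trans (hδ _ _ _ _ hroot hroot)
  let φ : S.carrier → BoundedContinuousFunction I ℝ := fun x =>
    BoundedContinuousFunction.ofNormedAddCommGroup (fun i => dist x i.1.1 - dist S.root i.1.1)
      (by fun_prop) (dist x S.root) fun i => by
        rw [Real.norm_eq_abs]; exact abs_dist_sub_le _ _ _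
  let ψ : T.carrier → BoundedContinuousFunction I ℝ := fun y =>
    BoundedContinuousFunction.ofNormedAddCommGroup (fun i => dist y i.1.2 - dist T.root i.1.2)
      (by fun_prop) (dist y T.root) fun i => by
        rw [Real.norm_eq_abs]; exact abs_dist_sub_le _ _ _
  have hφ : Isometry φ := Isometry.of_dist_eq fun x x' => by
    apply le_antisymm
    · refine (BoundedContinuousFunction.dist_le dist_nonneg).2 fun i => ?_
      change |dist x i.1.1 - dist S.root i.1.1 - (dist x' i.1.1 - dist S.root i.1.1)| ≤ _
      rw [sub_sub_sub_cancel_right]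
      exact abs_dist_sub_le _ _ _
    · obtain ⟨y, hy⟩ := hS x'
      refine le_trans ?_ (BoundedContinuousFunction.dist_coe_le_dist (⟨(x', y), hy⟩ : I))
      change _ ≤ |dist x x' - dist S.root x' - (dist x' x' - dist S.root x')|
      rw [sub_sub_sub_cancel_right, dist_self, sub_zero]
      exact le_abs_self _
  have hψ : Isometry ψ := Isometry.of_dist_eq fun y y' => by
    apply le_antisymm
    · refine (BoundedContinuousFunction.dist_le dist_nonneg).2 fun i => ?_
      change |dist y i.1.2 - dist T.root i.1.2 - (dist y' i.1.2 - dist T.root i.1.2)| ≤ _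
      rw [sub_sub_sub_cancel_right]
      exact abs_dist_sub_le _ _ _
    · obtain ⟨x, hx⟩ := hT y'
      refine le_trans ?_ (BoundedContinuousFunction.dist_coe_le_dist (⟨(x, y'), hx⟩ : I))
      change _ ≤ |dist y y' - dist T.root y' - (dist y' y' - dist T.root y')|
      rw [sub_sub_sub_cancel_right, dist_self, sub_zero]
      exact le_abs_self _
  have hφψ : φ S.root = ψ T.root := by
    ext i
    change dist S.root i.1.1 - dist S.root i.1.1 = dist T.root i.1.2 - dist T.root i.1.2
    rw [sub_self, sub_self]
  let Z : Set (BoundedContinuousFunction I ℝ) := Set.range φ ∪ Set.range ψ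
  have hZ : CompactSpace Z := isCompact_iff_compactSpace.1
    ((isCompact_range hφ.continuous).union (isCompact_range hψ.continuous))
  let : MeasurableSpace Z := _root_.borel Z
  have : BorelSpace Z := ⟨rfl⟩
  refine ⟨{ carrier := Z, root := ⟨φ S.root, Or.inl ⟨_, rfl⟩⟩ },
    { toFun := fun x => ⟨φ x, Or.inl ⟨x, rfl⟩⟩, isometry := hφ, map_root := rfl },
    { toFun := fun y => ⟨ψ y, Or.inr ⟨y, rfl⟩⟩, isometry := hψ
      map_root := Subtype.ext hφψ.symm }, fun x y hxy => ?_⟩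
  change dist (φ x) (ψ y) ≤ 2 * δ
  refine (BoundedContinuousFunction.dist_le (by positivity)).2 fun i => ?_
  change |dist x i.1.1 - dist S.root i.1.1 - (dist y i.1.2 - dist T.root i.1.2)| ≤ _
  have h1 := abs_le.1 (hδ _ _ _ _ hxy i.2)
  have h2 := abs_le.1 (hδ _ _ _ _ hroot i.2)
  exact abs_le.2 ⟨by linarith [h1.1, h2.2], by linarith [h1.2, h2.1]⟩

/-- A one-sided Prohorov bound passes from one pair of maps into a metric space to another if points
that are close in the first space are close in the second. -/
theorem measure_le_thickening_add_of_edist_lt {X Y M M' : Type*} [MeasurableSpace X]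
    [MeasurableSpace Y] [PseudoEMetricSpace M] [MeasurableSpace M] [OpensMeasurableSpace M]
    [PseudoEMetricSpace M'] [MeasurableSpace M'] [OpensMeasurableSpace M'] {ν : Measure X}
    {μ : Measure Y} {f : X → M} {g : Y → M} {f' : X → M'} {g' : Y → M'}
    (hf : MeasurableEmbedding f) (hg : Measurable g) (hf' : Measurable f') (hg' : Measurable g')
    {ε ε' : ℝ} (hε : 0 < ε)
    (h : levyProkhorovEDist (ν.map f) (μ.map g) < ENNReal.ofReal ε)
    (hclose : ∀ x y, edist (f x) (g y) < ENNReal.ofReal ε →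
      edist (f' x) (g' y) < ENNReal.ofReal ε') {B : Set M'} (hB : MeasurableSet B) :
    ν (f' ⁻¹' B) ≤ μ.map g' (Metric.thickening ε' B) + ENNReal.ofReal ε := by
  have hB' : MeasurableSet (f '' (f' ⁻¹' B)) := hf.measurableSet_image.2 (hf' hB)
  have h1 := left_measure_le_of_levyProkhorovEDist_lt h hB'
  rw [hf.map_apply, Set.preimage_image_eq _ hf.injective, ENNReal.toReal_ofReal hε.le,
    Measure.map_apply hg Metric.isOpen_thickening.measurableSet] at h1
  refine h1.trans ?_
  rw [Measure.map_apply hg' Metric.isOpen_thickening.measurableSet]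
  gcongr
  intro y hy
  obtain ⟨_, ⟨x, hx, rfl⟩, hxy⟩ := (Metric.mem_thickening_iff_exists_edist_lt _ _).1 hy
  rw [edist_comm] at hxy
  have := hclose x y hxy
  rw [edist_comm] at this
  exact (Metric.mem_thickening_iff_exists_edist_lt _ _).2 ⟨f' x, hx, this⟩

/-- A Prohorov bound passes from one pair of maps into a metric space to another if points that are
close in the first space are close in the second. Here `ν'` may differ from the image of `ν` by a
mass of at most `κ`. -/
theorem levyProkhorovEDist_le_of_edist_lt {X Y M M' : Type*} [MeasurableSpace X]
    [MeasurableSpace Y] [PseudoEMetricSpace M] [MeasurableSpace M] [OpensMeasurableSpace M]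
    [PseudoEMetricSpace M'] [MeasurableSpace M'] [OpensMeasurableSpace M'] {ν : Measure X}
    {μ : Measure Y} {f : X → M} {g : Y → M} {f' : X → M'} {g' : Y → M'}
    (hf : MeasurableEmbedding f) (hg : MeasurableEmbedding g) (hf' : Measurable f')
    (hg' : Measurable g') {ε ε' : ℝ} (hε : 0 < ε) (hεε' : ε ≤ ε')
    (h : levyProkhorovEDist (ν.map f) (μ.map g) < ENNReal.ofReal ε)
    (hclose : ∀ x y, edist (f x) (g y) < ENNReal.ofReal ε →
      edist (f' x) (g' y) < ENNReal.ofReal ε') {ν' : Measure M'} {κ : ℝ} (hκ : 0 ≤ κ)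
    (h₁ : ∀ B, MeasurableSet B → ν' B ≤ ν (f' ⁻¹' B) + ENNReal.ofReal κ)
    (h₂ : ∀ B, MeasurableSet B → ν (f' ⁻¹' B) ≤ ν' B + ENNReal.ofReal κ) :
    levyProkhorovEDist ν' (μ.map g') ≤ ENNReal.ofReal (ε' + κ) := by
  have hε' := hε.trans_le hεε'
  refine levyProkhorovEDist_le_of_forall _ _ _ fun r B hr hr' hB => ?_
  have hr'' : ε' + κ ≤ r.toReal := (ENNReal.ofReal_le_iff_le_toReal hr'.ne).1 hr.le
  have hadd : ENNReal.ofReal ε + ENNReal.ofReal κ ≤ r := by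
    rw [← ENNReal.ofReal_add hε.le hκ]
    exact (ENNReal.ofReal_le_ofReal (by linarith)).trans hr.le
  have hsub : Metric.thickening ε' B ⊆ Metric.thickening r.toReal B :=
    Metric.thickening_mono (by linarith) B
  constructor
  · calc ν' B ≤ ν (f' ⁻¹' B) + ENNReal.ofReal κ := h₁ B hB
      _ ≤ μ.map g' (Metric.thickening ε' B) + ENNReal.ofReal ε + ENNReal.ofReal κ := by
        gcongr
        exact measure_le_thickening_add_of_edist_lt hf hg.measurable hf' hg' hε h hclose hB
      _ ≤ _ := by
        rw [add_assoc]
        gcongr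
  · have hclose' : ∀ y x, edist (g y) (f x) < ENNReal.ofReal ε →
        edist (g' y) (f' x) < ENNReal.ofReal ε' := fun y x hxy => by
      rw [edist_comm] at hxy ⊢
      exact hclose x y hxy
    rw [levyProkhorovEDist_comm] at h
    have h3 := measure_le_thickening_add_of_edist_lt hg hf.measurable hg' hf' hε h hclose' hB
    have ho : MeasurableSet (Metric.thickening ε' B) := Metric.isOpen_thickening.measurableSet
    rw [Measure.map_apply hf' ho] at h3
    rw [Measure.map_apply hg' hB]
    calc μ (g' ⁻¹' B) ≤ ν (f' ⁻¹' Metric.thickening ε' B) + ENNReal.ofReal ε := h3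
      _ ≤ ν' (Metric.thickening ε' B) + ENNReal.ofReal κ + ENNReal.ofReal ε := by
        gcongr
        exact h₂ _ ho
      _ ≤ _ := by
        rw [add_assoc, add_comm (ENNReal.ofReal κ)]
        gcongr

theorem MarkedSpace.RootedEmbedding.measurableEmbedding_prodMap {S M : RootedCompact.{u}}
    (f : MarkedSpace.RootedEmbedding S M) :
    MeasurableEmbedding (Prod.map f.toFun (id : ℝ≥0 → ℝ≥0)) :=
  (f.isometry.isClosedEmbedding.measurableEmbedding).prodMap MeasurableEmbedding.id

/-- A common embedding of `S` and `T` is turned into one of spaces `S'` and `T'` onto which they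
map. -/
theorem MarkedSpace.gromovDist_le_of_embeddings {ι : Type} {S T : MarkedSpace.{u} ι}
    {S' T' : MarkedSpace.{u} Empty} {φ : S.carrier → S'.carrier} {ψ : T.carrier → T'.carrier}
    (hφ : Measurable φ) (hψ : Measurable ψ) (hφs : Function.Surjective φ)
    (hψs : Function.Surjective ψ) (hφr : φ S.root = S'.root) (hψr : ψ T.root = T'.root)
    (hψμ : T'.measure = T.measure.map (Prod.map ψ id)) {κ : ℝ} (hκ : 0 ≤ κ)
    (h₁ : ∀ B, MeasurableSet B →
      S'.measure B ≤ S.measure (Prod.map φ id ⁻¹' B) + ENNReal.ofReal κ)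
    (h₂ : ∀ B, MeasurableSet B →
      S.measure (Prod.map φ id ⁻¹' B) ≤ S'.measure B + ENNReal.ofReal κ)
    {M : RootedCompact.{u}} (f : RootedEmbedding S.toRootedCompact M)
    (g : RootedEmbedding T.toRootedCompact M) {ε δ : ℝ} (hε : 0 < ε)
    (hH : Metric.hausdorffEDist (Set.range f.toFun) (Set.range g.toFun) < ENNReal.ofReal ε)
    (hP : levyProkhorovEDist (S.measure.map (Prod.map f.toFun id))
      (T.measure.map (Prod.map g.toFun id)) < ENNReal.ofReal ε)
    (hδ : ∀ x x' y y', dist (f.toFun x) (g.toFun y) < ε → dist (f.toFun x') (g.toFun y') < ε →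
      |dist (φ x) (φ x') - dist (ψ y) (ψ y')| ≤ δ) :
    gromovDist S' T' ≤ ENNReal.ofReal (ε + 2 * δ + κ) := by
  let C : S'.carrier → T'.carrier → Prop := fun x' y' =>
    ∃ x y, φ x = x' ∧ ψ y = y' ∧ dist (f.toFun x) (g.toFun y) < ε
  have hlt : ∀ p q : M.carrier, edist p q < ENNReal.ofReal ε ↔ dist p q < ε := fun p q => by
    rw [edist_dist, ENNReal.ofReal_lt_ofReal_iff hε]
  have hroot : dist (f.toFun S.root) (g.toFun T.root) < ε := by
    rw [f.map_root, g.map_root, dist_self]; exact hε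
  have hδ0 : 0 ≤ δ := (abs_nonneg _).trans (hδ _ _ _ _ hroot hroot)
  obtain ⟨M', f', g', hfg⟩ := RootedCompact.exists_embeddings S'.toRootedCompact
    T'.toRootedCompact C
    (fun x' => by
      obtain ⟨x, rfl⟩ := hφs x'
      obtain ⟨_, ⟨y, rfl⟩, hy⟩ := Metric.exists_edist_lt_of_hausdorffEDist_lt
        (Set.mem_range_self x) hH
      exact ⟨ψ y, x, y, rfl, rfl, (hlt _ _).1 hy⟩)
    (fun y' => by
      obtain ⟨y, rfl⟩ := hψs y'
      rw [Metric.hausdorffEDist_comm] at hH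
      obtain ⟨_, ⟨x, rfl⟩, hx⟩ := Metric.exists_edist_lt_of_hausdorffEDist_lt
        (Set.mem_range_self y) hH
      exact ⟨φ x, x, y, rfl, rfl, by rw [dist_comm]; exact (hlt _ _).1 hx⟩)
    ⟨S.root, T.root, hφr, hψr, hroot⟩ (δ := δ)
    (by
      rintro _ _ _ _ ⟨x, y, rfl, rfl, h⟩ ⟨x', y', rfl, rfl, h'⟩
      exact hδ x x' y y' h h')
  have hfg' : ∀ x y, dist (f.toFun x) (g.toFun y) < ε →
      edist (f'.toFun (φ x)) (g'.toFun (ψ y)) ≤ ENNReal.ofReal (2 * δ) := fun x y h => by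
    rw [edist_dist]
    exact ENNReal.ofReal_le_ofReal (hfg _ _ ⟨x, y, rfl, rfl, h⟩)
  have hle : ENNReal.ofReal (2 * δ) ≤ ENNReal.ofReal (ε + 2 * δ + κ) :=
    ENNReal.ofReal_le_ofReal (by linarith)
  refine iInf_le_of_le M' (iInf_le_of_le f' (iInf_le_of_le g' (max_le ?_ (max_le ?_ (by simp)))))
  · refine (Metric.hausdorffEDist_le_of_mem_edist ?_ ?_).trans hle
    · rintro _ ⟨x', rfl⟩
      obtain ⟨x, rfl⟩ := hφs x'
      obtain ⟨_, ⟨y, rfl⟩, hy⟩ := Metric.exists_edist_lt_of_hausdorffEDist_lt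
        (Set.mem_range_self x) hH
      exact ⟨_, ⟨ψ y, rfl⟩, hfg' x y ((hlt _ _).1 hy)⟩
    · rintro _ ⟨y', rfl⟩
      obtain ⟨y, rfl⟩ := hψs y'
      rw [Metric.hausdorffEDist_comm] at hH
      obtain ⟨_, ⟨x, rfl⟩, hx⟩ := Metric.exists_edist_lt_of_hausdorffEDist_lt
        (Set.mem_range_self y) hH
      rw [hlt, dist_comm] at hx
      refine ⟨_, ⟨φ x, rfl⟩, ?_⟩
      rw [edist_comm]
      exact hfg' x y hx
  · have hg'm := g'.measurableEmbedding_prodMap.measurable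
    have hf'm := f'.measurableEmbedding_prodMap.measurable
    have hφm : Measurable (Prod.map φ (id : ℝ≥0 → ℝ≥0)) := hφ.prodMap measurable_id
    have hψm : Measurable (Prod.map ψ (id : ℝ≥0 → ℝ≥0)) := hψ.prodMap measurable_id
    rw [hψμ, Measure.map_map hg'm hψm]
    refine levyProkhorovEDist_le_of_edist_lt (f' := Prod.map f'.toFun id ∘ Prod.map φ id)
      f.measurableEmbedding_prodMap g.measurableEmbedding_prodMap
      (hf'm.comp hφm) (hg'm.comp hψm) hε (by linarith) hP ?_ hκ ?_ ?_
    · rintro ⟨x, s⟩ ⟨y, t⟩ hxy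
      obtain ⟨h3, h4⟩ := max_lt_iff.1 hxy
      refine max_lt ?_ ?_
      · refine (hfg' x y ((hlt _ _).1 h3)).trans_lt ?_
        exact (ENNReal.ofReal_lt_ofReal_iff (by linarith)).2 (by linarith)
      · exact h4.trans_le (ENNReal.ofReal_le_ofReal (by linarith))
    · intro B hB
      rw [Measure.map_apply hf'm hB]
      exact h₁ _ (hf'm hB)
    · intro B hB
      rw [Measure.map_apply hf'm hB]
      exact h₂ _ (hf'm hB)

/-! ### The conductance measures of networks -/

namespace ElectricalNetwork

variable {V : Type u} [Fintype V] (G : ElectricalNetwork V)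

/-- The vertices as points of the marked space, which is definitionally the vertex set with the
rescaled resistance metric. Networks with the same vertices have different marked spaces, and this
map keeps the points of these spaces apart. -/
def vertexEquiv (α β : ℝ) (hα : 0 < α) (ρ : V) {ι : Type} (p : ι → V) :
    V ≃ (G.markedSpace α β hα ρ p).carrier := Equiv.refl V

theorem markedSpace_measure_apply (α β : ℝ) (hα : 0 < α) (ρ : V) {ι : Type} (p : ι → V)
    {B : Set ((G.markedSpace α β hα ρ p).carrier × ℝ≥0)} (hB : MeasurableSet B) :
    (G.markedSpace α β hα ρ p).measure B =
      ENNReal.ofReal β⁻¹ *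
        ({x | (G.vertexEquiv α β hα ρ p x, G.totalCond x) ∈ B}.encard : ℝ≥0∞) := by
  let : MetricSpace V := scaledMetric G.resistanceForm.metricSpace α⁻¹ (inv_pos.2 hα)
  let : MeasurableSpace V := borel V
  have : BorelSpace V := ⟨rfl⟩
  have hm : Measurable fun x => (x, G.totalCond x) := measurable_of_finite _
  have h : ∀ B : Set (V × ℝ≥0), MeasurableSet B →
      (ENNReal.ofReal β⁻¹ • (Measure.count : Measure V).map (fun x => (x, G.totalCond x))) B =
        ENNReal.ofReal β⁻¹ * ({x | (x, G.totalCond x) ∈ B}.encard : ℝ≥0∞) := fun B hB => by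
    rw [Measure.smul_apply, smul_eq_mul, Measure.map_apply hm hB, Measure.count_apply (hm hB)]
    rfl
  exact h B hB

theorem addEdges_totalCond {N : ℕ} {a b : Fin N → V} (hab : ∀ i, a i ≠ b i) {x : V}
    (hx : x ∉ Set.range a ∪ Set.range b) : (G.addEdges a b hab).totalCond x = G.totalCond x := by
  refine Finset.sum_congr rfl fun y _ => Subtype.ext ?_
  change (G.addEdges a b hab).cond x y = G.cond x y
  unfold addEdges
  dsimp only
  rw [if_neg]
  rintro ⟨i, hi⟩
  rcases Sym2.eq_iff.1 hi with ⟨rfl, -⟩ | ⟨rfl, -⟩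
  · exact hx (Or.inl ⟨i, rfl⟩)
  · exact hx (Or.inr ⟨i, rfl⟩)

end ElectricalNetwork

/-! ### Marked spaces of networks and fused spaces -/

theorem ElectricalNetwork.dist_vertexEquiv {V : Type u} [Fintype V] (G : ElectricalNetwork V)
    (α β : ℝ) (hα : 0 < α) (ρ : V) {ι : Type} (p : ι → V) (x y : V) :
    dist (G.vertexEquiv α β hα ρ p x) (G.vertexEquiv α β hα ρ p y) =
      α⁻¹ * G.resistanceForm.resistance x y := rfl

theorem ElectricalNetwork.measurable_markedSpace {V : Type u} [Fintype V] (G : ElectricalNetwork V)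
    (α β : ℝ) (hα : 0 < α) (ρ : V) {ι : Type} (p : ι → V) {Y : Type*} [MeasurableSpace Y]
    (φ : (G.markedSpace α β hα ρ p).carrier → Y) : Measurable φ := by
  have : Finite (G.markedSpace α β hα ρ p).carrier := inferInstanceAs (Finite V)
  exact measurable_of_finite _

section Fused

variable {F : Type u} [MetricSpace F] [CompactSpace F] [MeasurableSpace F] [BorelSpace F]
    (E : ResistanceForm F) (hE : ∀ x y, E.resistance x y = dist x y) (ρ : F) (μ : Measure (F × ℝ≥0))
    [IsFiniteMeasure μ] {κ : Type} [Finite κ] (Γ : κ → Set F) (hΓ : ∀ i, (Γ i).Finite)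

/-- The canonical map onto the fused space. -/
def toFusedSpace : F → (fusedSpace E hE ρ μ Γ hΓ).carrier := fuseMap Γ

theorem measurable_toFusedSpace : Measurable (toFusedSpace E hE ρ μ Γ hΓ) :=
  @Continuous.measurable F (fusedSpace E hE ρ μ Γ hΓ).carrier _ _ _ _ _ _ _
    (E.fuse_continuous Γ hE hΓ)

theorem fusedSpace_measure : (fusedSpace E hE ρ μ Γ hΓ).measure =
    μ.map (Prod.map (toFusedSpace E hE ρ μ Γ hΓ) id) := rfl

theorem dist_toFusedSpace (x y : F) :
    dist (toFusedSpace E hE ρ μ Γ hΓ x) (toFusedSpace E hE ρ μ Γ hΓ y) =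
      (E.fuse Γ hΓ).resistance (fuseMap Γ x) (fuseMap Γ y) := rfl

end Fused

/-- Functions that differ only at the points `a i` and `b i` have graphs that meet any set in almost
the same number of points. -/
theorem encard_graph_preimage_le {V Y : Type*} {N : ℕ} (a b : Fin N → V) {t t' : V → ℝ≥0}
    (h : ∀ x ∉ Set.range a ∪ Set.range b, t x = t' x) (e : V → Y) (B : Set (Y × ℝ≥0)) :
    ({x | (e x, t x) ∈ B}.encard : ℝ≥0∞) ≤ ({x | (e x, t' x) ∈ B}.encard : ℝ≥0∞) + 2 * N := by
  have hr : ∀ c : Fin N → V, (Set.range c).encard ≤ N := fun c => by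
    rw [← Set.image_univ]
    refine (Set.encard_image_le _ _).trans ?_
    simp [Set.encard_univ]
  have h1 : {x | (e x, t x) ∈ B} ⊆ {x | (e x, t' x) ∈ B} ∪ (Set.range a ∪ Set.range b) := by
    intro x hx
    by_cases hx' : x ∈ Set.range a ∪ Set.range b
    · exact Or.inr hx'
    · left
      change (e x, t' x) ∈ B
      rw [← h x hx']
      exact hx
  have h2 : {x | (e x, t x) ∈ B}.encard ≤ {x | (e x, t' x) ∈ B}.encard + 2 * N := by
    refine (Set.encard_le_encard h1).trans ((Set.encard_union_le _ _).trans ?_)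
    rw [two_mul]
    gcongr
    exact (Set.encard_union_le _ _).trans (add_le_add (hr a) (hr b))
  have h3 := ENat.toENNReal_le.2 h2
  simpa using h3

/-- Unfolding of `gromovDist < ε` for a network and a resistance metric space: there is a common
embedding for which the correspondence of the points at distance less than `ε` has distortion at
most `2 ε`. -/
theorem exists_embeddings_of_gromovDist_lt {V : Type u} [Fintype V] (G : ElectricalNetwork V)
    (ρG : V) {ι : Type} (p : ι → V)
    {F : Type u} [MetricSpace F] [CompactSpace F] [MeasurableSpace F] [BorelSpace F]
    (E : ResistanceForm F) (hE : ∀ x y, E.resistance x y = dist x y) (ρ : F) (q : ι → F)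
    (μ : Measure (F × ℝ≥0)) [IsFiniteMeasure μ] {α β : ℝ} (hα : 0 < α) {ε : ℝ} (hε : 0 < ε)
    (h : MarkedSpace.gromovDist (G.markedSpace α β hα ρG p) (limitSpace F ρ μ q) <
      ENNReal.ofReal ε) :
    ∃ (M : RootedCompact.{u})
      (f : MarkedSpace.RootedEmbedding (G.markedSpace α β hα ρG p).toRootedCompact M)
      (g : MarkedSpace.RootedEmbedding (limitSpace F ρ μ q).toRootedCompact M),
      Metric.hausdorffEDist (Set.range f.toFun) (Set.range g.toFun) < ENNReal.ofReal ε ∧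
      levyProkhorovEDist ((G.markedSpace α β hα ρG p).measure.map (Prod.map f.toFun id))
        ((limitSpace F ρ μ q).measure.map (Prod.map g.toFun id)) < ENNReal.ofReal ε ∧
      (∀ i, dist (f.toFun (p i)) (g.toFun (q i)) < ε) ∧
      ∀ (x x' : V) (y y' : F), dist (f.toFun x) (g.toFun y) < ε →
        dist (f.toFun x') (g.toFun y') < ε →
        |α⁻¹ * G.resistanceForm.resistance x x' - E.resistance y y'| ≤ 2 * ε := by
  simp only [MarkedSpace.gromovDist, iInf_lt_iff] at h
  obtain ⟨M, f, g, hfg⟩ := h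
  obtain ⟨hH, hfg⟩ := max_lt_iff.1 hfg
  obtain ⟨hP, hpt⟩ := max_lt_iff.1 hfg
  refine ⟨M, f, g, hH, hP, fun i => ?_, fun x x' y y' h h' => ?_⟩
  · have := (le_iSup (fun i => edist (f.toFun (p i)) (g.toFun (q i))) i).trans_lt hpt
    rwa [edist_dist, ENNReal.ofReal_lt_ofReal_iff hε] at this
  · have h1 : dist (f.toFun x) (f.toFun x') = α⁻¹ * G.resistanceForm.resistance x x' :=
      f.isometry.dist_eq x x'
    have h2 : dist (g.toFun y) (g.toFun y') = E.resistance y y' :=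
      (g.isometry.dist_eq y y').trans (hE y y').symm
    rw [← h1, ← h2]
    have h3 := abs_le.1 (dist_dist_dist_le (f.toFun x) (f.toFun x') (g.toFun y) (g.toFun y'))
    exact abs_le.2 ⟨by linarith [h3.1], by linarith [h3.2]⟩

/-- A bound for the distance of a network with additional edges from a fused space, in terms of a
common embedding of the original network and the original space. -/
theorem gromovDist_addEdges_fusedSpace_le {N : ℕ} {V : Type u} [Fintype V] (G : ElectricalNetwork V)
    (ρG : V) {a b : Fin N → V} (hab : ∀ i, a i ≠ b i) {ι : Type} (p : ι → V)
    {F : Type u} [MetricSpace F] [CompactSpace F] [MeasurableSpace F] [BorelSpace F]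
    (E : ResistanceForm F) (hE : ∀ x y, E.resistance x y = dist x y) (ρ : F) (q : ι → F)
    (μ : Measure (F × ℝ≥0)) [IsFiniteMeasure μ] {κ : Type} [Finite κ] (Γ : κ → Set F)
    (hΓ : ∀ i, (Γ i).Finite) {α β : ℝ} (hα : 0 < α) (hβ : 0 < β) {M : RootedCompact.{u}}
    (f : MarkedSpace.RootedEmbedding (G.markedSpace α β hα ρG p).toRootedCompact M)
    (g : MarkedSpace.RootedEmbedding (limitSpace F ρ μ q).toRootedCompact M) {ε δ : ℝ} (hε : 0 < ε)
    (hH : Metric.hausdorffEDist (Set.range f.toFun) (Set.range g.toFun) < ENNReal.ofReal ε)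
    (hP : levyProkhorovEDist ((G.markedSpace α β hα ρG p).measure.map (Prod.map f.toFun id))
      ((limitSpace F ρ μ q).measure.map (Prod.map g.toFun id)) < ENNReal.ofReal ε)
    (hδ : ∀ (x x' : V) (y y' : F), dist (f.toFun x) (g.toFun y) < ε →
      dist (f.toFun x') (g.toFun y') < ε →
      |α⁻¹ * (G.addEdges a b hab).resistanceForm.resistance x x' -
        (E.fuse Γ hΓ).resistance (fuseMap Γ y) (fuseMap Γ y')| ≤ δ) :
    MarkedSpace.gromovDist ((G.addEdges a b hab).markedSpace α β hα ρG Empty.elim)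
      (fusedSpace E hE ρ μ Γ hΓ) ≤ ENNReal.ofReal (ε + 2 * δ + β⁻¹ * (2 * N)) := by
  let e := G.vertexEquiv α β hα ρG p
  let e' := (G.addEdges a b hab).vertexEquiv α β hα ρG (Empty.elim : Empty → V)
  have hφ : Measurable (e' ∘ e.symm) := G.measurable_markedSpace α β hα ρG p _
  have hS : ∀ B : Set (((G.addEdges a b hab).markedSpace α β hα ρG Empty.elim).carrier × ℝ≥0),
      MeasurableSet B → (G.markedSpace α β hα ρG p).measure (Prod.map (e' ∘ e.symm) id ⁻¹' B) =
      ENNReal.ofReal β⁻¹ * ({x | (e' x, G.totalCond x) ∈ B}.encard : ℝ≥0∞) := fun B hB => by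
    rw [G.markedSpace_measure_apply _ _ _ _ _ ((hφ.prodMap measurable_id) hB)]
    simp only [Set.mem_preimage, Prod.map_apply, Function.comp_apply, e, Equiv.symm_apply_apply, id]
  have hS' : ∀ B : Set (((G.addEdges a b hab).markedSpace α β hα ρG Empty.elim).carrier × ℝ≥0),
      MeasurableSet B → ((G.addEdges a b hab).markedSpace α β hα ρG Empty.elim).measure B =
      ENNReal.ofReal β⁻¹ *
        ({x | (e' x, (G.addEdges a b hab).totalCond x) ∈ B}.encard : ℝ≥0∞) :=
    fun B hB => ElectricalNetwork.markedSpace_measure_apply _ _ _ _ _ _ hB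
  have hκ : ENNReal.ofReal β⁻¹ * (2 * N) = ENNReal.ofReal (β⁻¹ * (2 * N)) := by
    rw [ENNReal.ofReal_mul (inv_nonneg.2 hβ.le), ENNReal.ofReal_mul zero_le_two,
      ENNReal.ofReal_ofNat, ENNReal.ofReal_natCast]
  refine MarkedSpace.gromovDist_le_of_embeddings hφ (measurable_toFusedSpace E hE ρ μ Γ hΓ)
    (e'.surjective.comp e.symm.surjective) (fuseMap_surjective Γ) (congrArg e' (e.symm_apply_apply ρG))
    rfl (fusedSpace_measure E hE ρ μ Γ hΓ) (mul_nonneg (inv_nonneg.2 hβ.le) (by positivity))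
    (fun B hB => ?_) (fun B hB => ?_) f g hε hH hP (fun x x' y y' h h' => ?_)
  · rw [hS B hB, hS' B hB, ← hκ, ← mul_add]
    gcongr
    exact encard_graph_preimage_le a b (fun x hx => G.addEdges_totalCond hab hx) e' B
  · rw [hS B hB, hS' B hB, ← hκ, ← mul_add]
    gcongr
    exact encard_graph_preimage_le a b (fun x hx => (G.addEdges_totalCond hab hx).symm) e' B
  · have h1 := (G.addEdges a b hab).dist_vertexEquiv α β hα ρG (Empty.elim : Empty → V)
      (e.symm x) (e.symm x')
    have h2 := dist_toFusedSpace E hE ρ μ Γ hΓ y y'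
    have h3 := hδ (e.symm x) (e.symm x') y y' h h'
    rw [← h1, ← h2] at h3
    exact h3

theorem mainTheorem12 {N : ℕ}
    (V : ℕ → Type u) [∀ n, Fintype (V n)] (G : ∀ n, ElectricalNetwork (V n))
    (hunit : ∀ n x y, 0 < (G n).cond x y → (G n).cond x y = 1)
    (ρG : ∀ n, V n) (a b : ∀ n, Fin N → V n)
    (hab : ∀ n i, a n i ≠ b n i)
    (hpairs : ∀ n, Function.Injective fun i => s(a n i, b n i))
    (F : Type u) [MetricSpace F] [CompactSpace F] [MeasurableSpace F] [BorelSpace F]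
    (E : ResistanceForm F) (hE : ∀ x y, E.resistance x y = dist x y)
    (ρ : F) (a' b' : Fin N → F) (hdistinct : Function.Injective (Sum.elim a' b'))
    (μ : Measure (F × ℝ≥0)) [IsFiniteMeasure μ]
    (α β : ℕ → ℝ) (hα : ∀ n, 0 < α n) (hβ : ∀ n, 0 < β n)
    (hαβ : Tendsto (fun n => min (α n) (β n)) atTop atTop)
    (hconv : MarkedSpace.ConvergesTo
      (fun n => (G n).markedSpace (α n) (β n) (hα n) (ρG n) (Sum.elim (a n) (b n)))
      (limitSpace F ρ μ (Sum.elim a' b'))) :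
    MarkedSpace.ConvergesTo
      (fun n => ((G n).addEdges (a n) (b n) (hab n)).markedSpace (α n) (β n) (hα n) (ρG n)
        Empty.elim)
      (fusedSpace E hE ρ μ (fun i => {a' i, b' i}) (fun _ => Set.toFinite _)) := by
  refine ENNReal.tendsto_nhds_zero.2 fun τ hτ => ?_
  obtain ⟨r, hr0, hrτ⟩ : ∃ r : ℝ, 0 < r ∧ ENNReal.ofReal r ≤ τ := by
    rcases eq_or_ne τ ⊤ with rfl | hτ'
    · exact ⟨1, one_pos, le_top⟩
    · exact ⟨τ.toReal, ENNReal.toReal_pos hτ.ne' hτ', ENNReal.ofReal_toReal_le⟩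
  obtain ⟨η, hη0, hη⟩ := E.exists_abs_addEdges_resistance_sub_le hdistinct
    (D := Metric.diam (Set.univ : Set F))
    (fun x y => by
      rw [hE]
      exact Metric.dist_le_diam_of_mem isCompact_univ.isBounded (Set.mem_univ _) (Set.mem_univ _))
    (ε := r / 8) (by positivity)
  set ε := min (η / 2) (r / 4) with hε
  have hε0 : 0 < ε := by positivity
  have hεη : 2 * ε ≤ η := by linarith [min_le_left (η / 2) (r / 4)]
  have hεr : ε ≤ r / 4 := min_le_right _ _
  have hα' : ∀ᶠ n in atTop, (α n)⁻¹ ≤ η := by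
    filter_upwards [hαβ.eventually_ge_atTop η⁻¹] with n hn
    exact inv_le_of_inv_le₀ hη0 (hn.trans (min_le_left _ _))
  have hβ' : ∀ᶠ n in atTop, (β n)⁻¹ * (2 * N) ≤ r / 4 := by
    filter_upwards [hαβ.eventually_ge_atTop (2 * N / (r / 4))] with n hn
    rw [inv_mul_eq_div, div_le_comm₀ (hβ n) (by positivity)]
    exact hn.trans (min_le_right _ _)
  have hconv' := (tendsto_order.1 hconv).2 (ENNReal.ofReal ε) (ENNReal.ofReal_pos.2 hε0)
  filter_upwards [hα', hβ', hconv'] with n hαn hβn hn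
  obtain ⟨M, f, g, hH, hP, hpt, hdist⟩ := exists_embeddings_of_gromovDist_lt (G n) (ρG n)
    (Sum.elim (a n) (b n)) E hE ρ (Sum.elim a' b') μ (hα n) hε0 hn
  refine (gromovDist_addEdges_fusedSpace_le (G n) (ρG n) (hab n) (Sum.elim (a n) (b n)) E hE ρ
    (Sum.elim a' b') μ (fun i => {a' i, b' i}) (fun _ => Set.toFinite _) (hα n) (hβ n) f g hε0 hH hP
    (δ := r / 8) ?_).trans ((ENNReal.ofReal_le_ofReal (by linarith)).trans hrτ)
  exact hη (V n) (G n) (a n) (b n) (hab n) (hpairs n) _ (inv_nonneg.2 (hα n).le) hαn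
    (fun x y => dist (f.toFun x) (g.toFun y) < ε)
    (fun x x' y y' h h' => (hdist x x' y y' h h').trans hεη)
    (fun i => hpt (Sum.inl i)) (fun i => hpt (Sum.inr i))
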